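/- Let $Q$ be a finite quiver with vertex set $I$ and edge set $E$ (loops and multiple edges allowed). For $a,b\in\mathbb Z^I$ put $a\cdot b=\sum_{i}a_ib_i$, $\langle a,b\rangle=a\cdot b-\sum_{e:i\to j}a_ib_j$ and $(a,b)=\langle a,b\rangle+\langle b,a\rangle$. For $\mathbf v,\mathbf w\in\mathbb N^I$ (where $0\in\mathbb N$) fix complex vector spaces $V_i,W_i$ of dimensions $v_i,w_i$. A framed double quiver representation is a quadruple $(X_e,Y_e,A_i,B_i)$ of linear maps $X_e:V_i\to V_j$, $Y_e:V_j\to V_i$ (for each edge $e:i\to j$), $A_i:W_i\to V_i$, $B_i:V_i\to W_i$. It is stable if the only collection of subspaces $V'_i\subseteq V_i$ preserved by all $X_e,Y_e$ and containing all $\operatorname{Im}A_i$ is $V'_i=V_i$ for all $i$. The moment map $\mu$ has $i$-th component $\sum_{e:j\to i}X_eY_e-\sum_{e:i\to j}Y_eX_e+A_iB_i$. Let $\mathcal M_{\mathbf v,\mathbf w}=\mu^{-1}(0)^{s}/\prod_iGL(V_i)$ be the Nakajima quiver variety (the geometric quotient of the stable locus of $\mu^{-1}(0)$), and let $\mathcal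 V_i$ be its tautological bundles, with fibre $V_i$. The torus $T=\mathbb C^*\times(\mathbb C^*)^E\ni(q,t_e)$ acts by $(X_e,Y_e,A_i,B_i)\mapsto(X_e/t_e,\;t_eY_e/q,\;A_i,\;B_i/q)$; $q,t_e$ also denote the corresponding characters. Let $\mathbf v,\tilde{\mathbf v},\mathbf w,\tilde{\mathbf w}\in\mathbb N^I$, let $W_i,\tilde W_i$ be vector spaces of dimensions $w_i,\tilde w_i$, and let $\pi_i:\tilde W_i\to W_i$ $(i\in I)$ be arbitrary linear maps. Objects with a tilde refer to the second factor of $\mathcal M_{\mathbf v,\mathbf w}\times\mathcal M_{\tilde{\mathbf v},\tilde{\mathbf w}}$. On this product consider the $T$-equivariant vector bundles $$C_{-1}=\bigoplus_{i}\operatorname{Hom}(\tilde{\mathcal V}_i,\mathcal V_i),\qquad C_1=\bigoplus_i\operatorname{Hom}(q\tilde{\mathcal V}_i,\mathcal V_i),$$ $$C_0=\bigoplus_{e:i\to j}\Big(\operatorname{Hom}(t_e\tilde{\mathcal V}_i,\mathcal V_j)\oplus\operatorname{Hom}(\tfrac q{t_e}\tilde{\mathcal V}_j,\mathcal V_i)\Big)\oplus\bigoplus_i\Big(\operatorname{Hom}(\tilde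 W_i,\mathcal V_i)\oplus\operatorname{Hom}(q\tilde{\mathcal V}_i,W_i)\Big)$$ and the maps $C_{-1}\xrightarrow{f}C_0\xrightarrow{g}C_1$, $$f(\psi)=(X_e\psi_i-\psi_j\tilde X_e,\;Y_e\psi_j-\psi_i\tilde Y_e,\;\psi_i\tilde A_i,\;B_i\psi_i)_{e:i\to j},$$ $$g(x,y,a,b)_i=\sum_{e:j\to i}(X_ey_e+x_e\tilde Y_e)-\sum_{e:i\to j}(Y_ex_e+y_e\tilde X_e)+A_ib_i-a_i\tilde B_i .$$ Then: 1. $C_{-1}\to C_0\to C_1$ is a complex ($gf=0$) of vector bundles, and $f$ and $g$ are $T$-equivariant. 2. $f$ is fiberwise injective and $g$ is fiberwise surjective, and the middle cohomology $\mathcal E=\operatorname{Ker}g/\operatorname{Im}f$ is an algebraic vector bundle of rank $\mathbf w\cdot\tilde{\mathbf v}+\tilde{\mathbf w}\cdot\mathbf v-(\mathbf v,\tilde{\mathbf v})$. 3. $s=(0,0,A_i\pi_i,\pi_i\tilde B_i)$ lies in $\operatorname{Ker}g$ and defines a ($T$-invariant) global algebraic section of $\mathcal E$. It vanishes at a pair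 of framed double quiver representations if and only if there are linear maps $\psi_i:\tilde V_i\to V_i$ $(i\in I)$ with $$X_e\psi_i=\psi_j\tilde X_e,\qquad Y_e\psi_j=\psi_i\tilde Y_e,\qquad A_i\pi_i=\psi_i\tilde A_i,\qquad B_i\psi_i=\pi_i\tilde B_i$$ for all $e:i\to j$ in $E$ and all $i\in I$. 4. Such a collection $\psi$ is unique if it exists, and if all $\pi_i$ are surjective, then all $\psi_i$ are surjective. -/

import Mathlib

open scoped Topology

namespace NakajimaQuiver

noncomputable section

/-! ## Framed double quiver representations and the complex attached to a pair of them -/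

section LinearAlgebra

variable {I : Type*} [Quiver I]

/-- The vector space `⨁_i Hom(V'_i, V_i)`. -/
abbrev VertexHom (V' V : I → Type*)
    [∀ i, AddCommGroup (V' i)] [∀ i, Module ℂ (V' i)]
    [∀ i, AddCommGroup (V i)] [∀ i, Module ℂ (V i)] :=
  ∀ i, V' i →ₗ[ℂ] V i

/-- The vector space
`⨁_{e : i ⟶ j} (Hom(V'_i, V_j) ⊕ Hom(V'_j, V_i)) ⊕ ⨁_i (Hom(W'_i, V_i) ⊕ Hom(V'_i, W_i))`.
Its elements are the quadruples `(x_e, y_e, a_i, b_i)`. -/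
@[ext]
structure FramedHom (V' W' V W : I → Type*)
    [∀ i, AddCommGroup (V' i)] [∀ i, Module ℂ (V' i)]
    [∀ i, AddCommGroup (W' i)] [∀ i, Module ℂ (W' i)]
    [∀ i, AddCommGroup (V i)] [∀ i, Module ℂ (V i)]
    [∀ i, AddCommGroup (W i)] [∀ i, Module ℂ (W i)] where
  /-- `x_e : V'_i → V_j` for `e : i ⟶ j` -/
  x : ∀ {i j : I}, (i ⟶ j) → (V' i →ₗ[ℂ] V j)
  /-- `y_e : V'_j → V_i` for `e : i ⟶ j` -/
  y : ∀ {i j : I}, (i ⟶ j) → (V' j →ₗ[ℂ] V i)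
  /-- `a_i : W'_i → V_i` -/
  a : ∀ i : I, W' i →ₗ[ℂ] V i
  /-- `b_i : V'_i → W_i` -/
  b : ∀ i : I, V' i →ₗ[ℂ] W i

/-- A framed double quiver representation `(X_e, Y_e, A_i, B_i)` on `V_•` with framing `W_•`. -/
abbrev FramedRep (V W : I → Type*)
    [∀ i, AddCommGroup (V i)] [∀ i, Module ℂ (V i)]
    [∀ i, AddCommGroup (W i)] [∀ i, Module ℂ (W i)] :=
  FramedHom V W V W

variable {V' W' V W U' U : I → Type*}
  [∀ i, AddCommGroup (V' i)] [∀ i, Module ℂ (V' i)]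
  [∀ i, AddCommGroup (W' i)] [∀ i, Module ℂ (W' i)]
  [∀ i, AddCommGroup (V i)] [∀ i, Module ℂ (V i)]
  [∀ i, AddCommGroup (W i)] [∀ i, Module ℂ (W i)]
  [∀ i, AddCommGroup (U' i)] [∀ i, Module ℂ (U' i)]
  [∀ i, AddCommGroup (U i)] [∀ i, Module ℂ (U i)]

namespace FramedHom

/-- Quadruples as elements of a product of spaces of linear maps. -/
def equivProd : FramedHom V' W' V W ≃
    (∀ i j : I, (i ⟶ j) → (V' i →ₗ[ℂ] V j)) × (∀ i j : I, (i ⟶ j) → (V' j →ₗ[ℂ] V i)) ×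
      (∀ i : I, W' i →ₗ[ℂ] V i) × (∀ i : I, V' i →ₗ[ℂ] W i) where
  toFun c := (fun _ _ e => c.x e, fun _ _ e => c.y e, c.a, c.b)
  invFun d := ⟨fun {i j} e => d.1 i j e, fun {i j} e => d.2.1 i j e, d.2.2.1, d.2.2.2⟩
  left_inv _ := rfl
  right_inv _ := rfl

/-- Quadruples are added componentwise. -/
instance : AddCommGroup (FramedHom V' W' V W) := equivProd.addCommGroup

/-- Quadruples are multiplied by scalars componentwise. -/
instance : Module ℂ (FramedHom V' W' V W) := equivProd.module ℂ

@[simp] theorem add_x (c d : FramedHom V' W' V W) {i j : I} (e : i ⟶ j) :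
    (c + d).x e = c.x e + d.x e := rfl
@[simp] theorem add_y (c d : FramedHom V' W' V W) {i j : I} (e : i ⟶ j) :
    (c + d).y e = c.y e + d.y e := rfl
@[simp] theorem add_a (c d : FramedHom V' W' V W) (i : I) : (c + d).a i = c.a i + d.a i := rfl
@[simp] theorem add_b (c d : FramedHom V' W' V W) (i : I) : (c + d).b i = c.b i + d.b i := rfl
@[simp] theorem smul_x (t : ℂ) (c : FramedHom V' W' V W) {i j : I} (e : i ⟶ j) :
    (t • c).x e = t • c.x e := rfl
@[simp] theorem smul_y (t : ℂ) (c : FramedHom V' W' V W) {i j : I} (e : i ⟶ j) :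
    (t • c).y e = t • c.y e := rfl
@[simp] theorem smul_a (t : ℂ) (c : FramedHom V' W' V W) (i : I) : (t • c).a i = t • c.a i := rfl
@[simp] theorem smul_b (t : ℂ) (c : FramedHom V' W' V W) (i : I) : (t • c).b i = t • c.b i := rfl
@[simp] theorem zero_x {i j : I} (e : i ⟶ j) : (0 : FramedHom V' W' V W).x e = 0 := rfl
@[simp] theorem zero_y {i j : I} (e : i ⟶ j) : (0 : FramedHom V' W' V W).y e = 0 := rfl
@[simp] theorem zero_a (i : I) : (0 : FramedHom V' W' V W).a i = 0 := rfl
@[simp] theorem zero_b (i : I) : (0 : FramedHom V' W' V W).b i = 0 := rfl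

end FramedHom

/-- Functoriality of `⨁_i Hom(V'_i, V_i)` in `V_•` and `V'_•`. -/
def vertexMap (φ : ∀ i, V i →ₗ[ℂ] U i) (φ' : ∀ i, U' i →ₗ[ℂ] V' i) :
    VertexHom V' V →ₗ[ℂ] VertexHom U' U where
  toFun ψ := fun i => φ i ∘ₗ ψ i ∘ₗ φ' i
  map_add' _ _ := funext fun i => LinearMap.ext fun _ => map_add (φ i) _ _
  map_smul' _ _ := funext fun i => LinearMap.ext fun _ => map_smul (φ i) _ _

/-- Functoriality of the space of quadruples in `V_•` and `V'_•`. -/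
def framedMap (φ : ∀ i, V i →ₗ[ℂ] U i) (φ' : ∀ i, U' i →ₗ[ℂ] V' i) :
    FramedHom V' W' V W →ₗ[ℂ] FramedHom U' W' U W where
  toFun c := ⟨fun {i j} e => φ j ∘ₗ c.x e ∘ₗ φ' i,
    fun {i j} e => φ i ∘ₗ c.y e ∘ₗ φ' j,
    fun i => φ i ∘ₗ c.a i, fun i => c.b i ∘ₗ φ' i⟩
  map_add' c d := by
    refine FramedHom.ext ?_ ?_ ?_ ?_ <;> ext <;> simp
  map_smul' t c := by
    refine FramedHom.ext ?_ ?_ ?_ ?_ <;> ext <;> simp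

/-- Stability: a collection of subspaces that is preserved by all `X_e`, `Y_e` and contains all
`Im A_i` is everything. -/
def IsStable (p : FramedRep V W) : Prop :=
  ∀ S : ∀ i, Submodule ℂ (V i),
    (∀ (i j : I) (e : i ⟶ j), ∀ u ∈ S i, p.x e u ∈ S j) →
    (∀ (i j : I) (e : i ⟶ j), ∀ u ∈ S j, p.y e u ∈ S i) →
    (∀ i, LinearMap.range (p.a i) ≤ S i) →
    ∀ i, S i = ⊤

/-- A collection `ψ_i : V'_i → V_i` is a map of framed double quiver representations over the
collection `π_i : W'_i → W_i` of maps between the framings: all squares commute. -/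
structure IsFramedMorphism (π : ∀ i, W' i →ₗ[ℂ] W i) (p' : FramedRep V' W') (p : FramedRep V W)
    (ψ : ∀ i, V' i →ₗ[ℂ] V i) : Prop where
  x_comm : ∀ (i j : I) (e : i ⟶ j), p.x e ∘ₗ ψ i = ψ j ∘ₗ p'.x e
  y_comm : ∀ (i j : I) (e : i ⟶ j), p.y e ∘ₗ ψ j = ψ i ∘ₗ p'.y e
  a_comm : ∀ i, p.a i ∘ₗ π i = ψ i ∘ₗ p'.a i
  b_comm : ∀ i, p.b i ∘ₗ ψ i = π i ∘ₗ p'.b i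

/-- The first map of the complex:
`ψ ↦ (X_e ψ_i - ψ_j X'_e, Y_e ψ_j - ψ_i Y'_e, ψ_i A'_i, B_i ψ_i)`. -/
def complexF (p : FramedRep V W) (p' : FramedRep V' W') :
    VertexHom V' V →ₗ[ℂ] FramedHom V' W' V W where
  toFun ψ := ⟨fun {i j} e => p.x e ∘ₗ ψ i - ψ j ∘ₗ p'.x e,
    fun {i j} e => p.y e ∘ₗ ψ j - ψ i ∘ₗ p'.y e,
    fun i => ψ i ∘ₗ p'.a i, fun i => p.b i ∘ₗ ψ i⟩
  map_add' ψ χ := by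
    refine FramedHom.ext ?_ ?_ ?_ ?_ <;> ext <;> simp <;> abel
  map_smul' t ψ := by
    refine FramedHom.ext ?_ ?_ ?_ ?_ <;> ext <;> simp [smul_sub]

variable [Fintype I] [∀ i j : I, Fintype (i ⟶ j)]

/-- The quadratic moment map; its `i`-th component is
`∑_{e : j ⟶ i} X_e Y_e - ∑_{e : i ⟶ j} Y_e X_e + A_i B_i`. -/
def moment (p : FramedRep V W) : VertexHom V V := fun i =>
  (∑ j : I, ∑ e : j ⟶ i, p.x e ∘ₗ p.y e)
    - (∑ j : I, ∑ e : i ⟶ j, p.y e ∘ₗ p.x e)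
    + p.a i ∘ₗ p.b i

/-- The second map of the complex; its `i`-th component sends `(x, y, a, b)` to
`∑_{e : j ⟶ i} (X_e y_e + x_e Y'_e) - ∑_{e : i ⟶ j} (Y_e x_e + y_e X'_e) + A_i b_i - a_i B'_i`. -/
def complexG (p : FramedRep V W) (p' : FramedRep V' W') :
    FramedHom V' W' V W →ₗ[ℂ] VertexHom V' V where
  toFun c := fun i =>
    (∑ j : I, ∑ e : j ⟶ i,
        (p.x e ∘ₗ c.y e + c.x e ∘ₗ p'.y e))
      - (∑ j : I, ∑ e : i ⟶ j,
        (p.y e ∘ₗ c.x e + c.y e ∘ₗ p'.x e))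
      + (p.a i ∘ₗ c.b i - c.a i ∘ₗ p'.b i)
  map_add' c d := by
    refine funext fun i => ?_
    simp only [FramedHom.add_x, FramedHom.add_y, FramedHom.add_a, FramedHom.add_b,
      LinearMap.comp_add, LinearMap.add_comp, Finset.sum_add_distrib, Pi.add_apply]
    abel
  map_smul' t c := by
    refine funext fun i => ?_
    simp only [FramedHom.smul_x, FramedHom.smul_y, FramedHom.smul_a, FramedHom.smul_b,
      LinearMap.comp_smul, LinearMap.smul_comp, ← smul_add, ← smul_sub, ← Finset.smul_sum,
      RingHom.id_apply, Pi.smul_apply]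

/-- The middle cohomology `Ker g / Im f` of the complex attached to two framed representations. -/
abbrev MiddleCohomology (p : FramedRep V W) (p' : FramedRep V' W') :=
  ↥(LinearMap.ker (complexG p p')) ⧸
    (LinearMap.range (complexF p p')).submoduleOf (LinearMap.ker (complexG p p'))

/-- The quadruple `(0, 0, A_i π_i, π_i B'_i)`. -/
def sectionVector (π : ∀ i, W' i →ₗ[ℂ] W i) (p : FramedRep V W) (p' : FramedRep V' W') :
    FramedHom V' W' V W :=
  ⟨0, 0, fun i => p.a i ∘ₗ π i, fun i => π i ∘ₗ p'.b i⟩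

theorem sectionVector_mem_ker (π : ∀ i, W' i →ₗ[ℂ] W i) (p : FramedRep V W)
    (p' : FramedRep V' W') : sectionVector π p p' ∈ LinearMap.ker (complexG p p') := by
  rw [LinearMap.mem_ker]
  refine funext fun i => LinearMap.ext fun u => ?_
  simp [complexG, sectionVector]

/-- The class of `(0, 0, A_i π_i, π_i B'_i)` in the middle cohomology. -/
def sectionClass (π : ∀ i, W' i →ₗ[ℂ] W i) (p : FramedRep V W) (p' : FramedRep V' W') :
    MiddleCohomology p p' :=
  Submodule.Quotient.mk ⟨sectionVector π p p', sectionVector_mem_ker π p p'⟩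

end LinearAlgebra

/-! ## Nakajima quiver varieties -/

section Variety

set_option linter.unusedSectionVars false

variable {I : Type*} [Quiver I]

/-- The standard collection of vector spaces `ℂ^{n_i}`. -/
abbrev Std (n : I → ℕ) : I → Type := fun i => Fin (n i) → ℂ

/-- The group `G_v = ∏_i GL(V_i)`. -/
abbrev GaugeGroup (v : I → ℕ) := ∀ i, LinearMap.GeneralLinearGroup ℂ (Std v i)

/-- The torus `T = ℂ^* × (ℂ^*)^E` of pairs `(q, (t_e)_e)`. -/
abbrev Torus (I : Type*) [Quiver I] := ℂˣ × (∀ i j : I, (i ⟶ j) → ℂˣ)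

/-- The scaling `(x_e, y_e, a_i, b_i) ↦ (x_e / t_e, t_e y_e / q, a_i, b_i / q)`, i.e. the weights of
`Hom(t_e V'_i, V_j)`, `Hom((q / t_e) V'_j, V_i)`, `Hom(W'_i, V_i)` and `Hom(q V'_i, W_i)`. -/
def torusScale {V' W' V W : I → Type*}
    [∀ i, AddCommGroup (V' i)] [∀ i, Module ℂ (V' i)]
    [∀ i, AddCommGroup (W' i)] [∀ i, Module ℂ (W' i)]
    [∀ i, AddCommGroup (V i)] [∀ i, Module ℂ (V i)]
    [∀ i, AddCommGroup (W i)] [∀ i, Module ℂ (W i)] (τ : Torus I) :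
    FramedHom V' W' V W →ₗ[ℂ] FramedHom V' W' V W where
  toFun c := ⟨fun {i j} e => (τ.2 i j e : ℂ)⁻¹ • c.x e,
    fun {i j} e => ((τ.2 i j e : ℂ) / (τ.1 : ℂ)) • c.y e,
    fun i => c.a i, fun i => (τ.1 : ℂ)⁻¹ • c.b i⟩
  map_add' c d := by
    refine FramedHom.ext ?_ ?_ ?_ ?_ <;> ext <;>
      simp
  map_smul' t c := by
    refine FramedHom.ext ?_ ?_ ?_ ?_ <;> ext <;>
      simp [smul_comm t]

variable [Fintype I] [∀ i j : I, Fintype (i ⟶ j)]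

/-- The stable locus `μ⁻¹(0)^s` of the zero fibre of the moment map on the affine space of framed
double quiver representations on `V_i = ℂ^{v_i}` with framing `W_i = ℂ^{w_i}`. -/
@[ext]
structure StableRep (v w : I → ℕ) where
  /-- the quadruple `(X, Y, A, B)` -/
  rep : FramedRep (Std v) (Std w)
  moment_eq_zero : moment rep = 0
  stable : IsStable rep

variable {v w v' w' : I → ℕ}

theorem gauge_inv_apply (g : GaugeGroup v) (i : I) (u : Std v i) :
    ((g i)⁻¹ : LinearMap.GeneralLinearGroup ℂ (Std v i)).1 ((g i).1 u) = u := by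
  rw [← Module.End.mul_apply, ← Units.val_mul, inv_mul_cancel, Units.val_one, Module.End.one_apply]

theorem gauge_apply_inv (g : GaugeGroup v) (i : I) (u : Std v i) :
    (g i).1 (((g i)⁻¹ : LinearMap.GeneralLinearGroup ℂ (Std v i)).1 u) = u := by
  rw [← Module.End.mul_apply, ← Units.val_mul, mul_inv_cancel, Units.val_one, Module.End.one_apply]

/-- The action of `G_v` on quadruples: conjugation on `X` and `Y`, left multiplication on `A`,
right multiplication by the inverse on `B`. -/
def gaugeAct (g : GaugeGroup v) : FramedRep (Std v) (Std w) →ₗ[ℂ] FramedRep (Std v) (Std w) :=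
  framedMap (fun i => (g i).1) (fun i => ((g i)⁻¹ : LinearMap.GeneralLinearGroup ℂ (Std v i)).1)

theorem moment_gaugeAct (g : GaugeGroup v) {p : FramedRep (Std v) (Std w)} (hp : moment p = 0) :
    moment (gaugeAct g p) = 0 := by
  refine funext fun i => LinearMap.ext fun u => ?_
  have h := congrArg (g i).1 (LinearMap.congr_fun (congrFun hp i)
    (((g i)⁻¹ : LinearMap.GeneralLinearGroup ℂ (Std v i)).1 u))
  simp only [moment, Pi.zero_apply, LinearMap.add_apply, LinearMap.sub_apply,
    LinearMap.sum_apply, LinearMap.comp_apply, map_add, map_sub, map_sum, LinearMap.zero_apply,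
    map_zero] at h
  simpa only [moment, gaugeAct, framedMap, LinearMap.coe_mk, AddHom.coe_mk, LinearMap.add_apply, LinearMap.sub_apply,
    LinearMap.sum_apply, LinearMap.comp_apply, gauge_inv_apply, Pi.zero_apply,
    LinearMap.zero_apply] using h

theorem isStable_gaugeAct (g : GaugeGroup v) {p : FramedRep (Std v) (Std w)} (hp : IsStable p) :
    IsStable (gaugeAct g p) := by
  intro S hx hy ha i
  have h := hp (fun i => (S i).comap (g i).1) ?_ ?_ ?_ i
  · rw [eq_top_iff]
    intro u _
    have hu : ((g i)⁻¹ : LinearMap.GeneralLinearGroup ℂ (Std v i)).1 u ∈ (S i).comap (g i).1 := by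
      rw [h]; trivial
    simpa [gauge_apply_inv] using hu
  · intro i j e u hu
    simpa [gaugeAct, framedMap, gauge_inv_apply] using hx i j e _ hu
  · intro i j e u hu
    simpa [gaugeAct, framedMap, gauge_inv_apply] using hy i j e _ hu
  · rintro i _ ⟨u, rfl⟩
    exact ha i ⟨u, rfl⟩

theorem gaugeAct_one (p : FramedRep (Std v) (Std w)) : gaugeAct 1 p = p := by
  refine FramedHom.ext ?_ ?_ ?_ ?_ <;> ext <;>
    simp [gaugeAct, framedMap]

theorem gaugeAct_mul (g h : GaugeGroup v) (p : FramedRep (Std v) (Std w)) :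
    gaugeAct (g * h) p = gaugeAct g (gaugeAct h p) := by
  simp only [gaugeAct, framedMap, Pi.mul_apply, mul_inv_rev, Units.val_mul]
  rfl

instance : MulAction (GaugeGroup v) (StableRep v w) where
  smul g p := ⟨gaugeAct g p.rep, moment_gaugeAct g p.moment_eq_zero, isStable_gaugeAct g p.stable⟩
  one_smul p := StableRep.ext (gaugeAct_one p.rep)
  mul_smul g h p := StableRep.ext (gaugeAct_mul g h p.rep)

theorem gauge_smul_rep (g : GaugeGroup v) (p : StableRep v w) :
    (g • p).rep = gaugeAct g p.rep := rfl

theorem gauge_x (g : GaugeGroup v) (p : StableRep v w) {i j : I} (e : i ⟶ j) (u : Std v i) :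
    (g • p).rep.x e ((g i).1 u) = (g j).1 (p.rep.x e u) := by
  simp [gauge_smul_rep, gaugeAct, framedMap, gauge_inv_apply]

theorem gauge_y (g : GaugeGroup v) (p : StableRep v w) {i j : I} (e : i ⟶ j) (u : Std v j) :
    (g • p).rep.y e ((g j).1 u) = (g i).1 (p.rep.y e u) := by
  simp [gauge_smul_rep, gaugeAct, framedMap, gauge_inv_apply]

theorem gauge_a (g : GaugeGroup v) (p : StableRep v w) (i : I) (u : Std w i) :
    (g • p).rep.a i u = (g i).1 (p.rep.a i u) := rfl

theorem gauge_b (g : GaugeGroup v) (p : StableRep v w) (i : I) (u : Std v i) :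
    (g • p).rep.b i ((g i).1 u) = p.rep.b i u := by
  simp [gauge_smul_rep, gaugeAct, framedMap, gauge_inv_apply]

/-- The action of `G_v` on stable representations is free. -/
theorem gauge_free {g : GaugeGroup v} {p : StableRep v w} (h : g • p = p) : g = 1 := by
  have key := p.stable (fun i => LinearMap.ker ((g i).1 - LinearMap.id)) ?_ ?_ ?_
  · ext1 i
    refine Units.ext (LinearMap.ext fun u => ?_)
    have hu : u ∈ LinearMap.ker ((g i).1 - LinearMap.id) := by rw [key i]; trivial
    rw [LinearMap.mem_ker, LinearMap.sub_apply, sub_eq_zero] at hu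
    exact hu
  · intro i j e u hu
    rw [LinearMap.mem_ker, LinearMap.sub_apply, sub_eq_zero] at hu ⊢
    have h1 := gauge_x g p e u
    rw [h, hu] at h1
    exact h1.symm
  · intro i j e u hu
    rw [LinearMap.mem_ker, LinearMap.sub_apply, sub_eq_zero] at hu ⊢
    have h1 := gauge_y g p e u
    rw [h, hu] at h1
    exact h1.symm
  · rintro i _ ⟨u, rfl⟩
    rw [LinearMap.mem_ker, LinearMap.sub_apply, sub_eq_zero]
    have h1 := gauge_a g p i u
    rw [h] at h1
    exact h1.symm

theorem moment_torusScale (τ : Torus I) {p : FramedRep (Std v) (Std w)} (hp : moment p = 0) :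
    moment (torusScale τ p) = 0 := by
  have h : moment (torusScale τ p) = (τ.1 : ℂ)⁻¹ • moment p := by
    refine funext fun i => ?_
    have h1 : ∀ i j (e : i ⟶ j), (τ.2 i j e : ℂ)⁻¹ * (τ.2 i j e / τ.1) = (τ.1 : ℂ)⁻¹ :=
      fun i j e => by field_simp
    have h2 : ∀ i j (e : i ⟶ j), ((τ.2 i j e : ℂ) / τ.1) * (τ.2 i j e : ℂ)⁻¹ = (τ.1 : ℂ)⁻¹ :=
      fun i j e => by field_simp
    simp only [moment, torusScale, LinearMap.coe_mk, AddHom.coe_mk, Pi.smul_apply,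
      LinearMap.comp_smul, LinearMap.smul_comp, smul_smul, h1, h2, smul_sub, smul_add,
      Finset.smul_sum]
  rw [h, hp, smul_zero]

theorem isStable_torusScale (τ : Torus I) {p : FramedRep (Std v) (Std w)} (hp : IsStable p) :
    IsStable (torusScale τ p) := by
  intro S hx hy ha
  refine hp S ?_ ?_ ha
  · intro i j e u hu
    have h := (S j).smul_mem (τ.2 i j e : ℂ) (hx i j e u hu)
    simpa [torusScale, smul_smul] using h
  · intro i j e u hu
    have h := (S i).smul_mem ((τ.1 : ℂ) / (τ.2 i j e : ℂ)) (hy i j e u hu)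
    simpa [torusScale, smul_smul] using h

theorem torusScale_one (p : FramedRep (Std v) (Std w)) : torusScale (1 : Torus I) p = p := by
  refine FramedHom.ext ?_ ?_ ?_ ?_ <;> ext <;>
    simp [torusScale]

theorem torusScale_mul (τ σ : Torus I) (p : FramedRep (Std v) (Std w)) :
    torusScale (τ * σ) p = torusScale τ (torusScale σ p) := by
  simp only [torusScale, LinearMap.coe_mk, AddHom.coe_mk, Prod.fst_mul, Prod.snd_mul, Pi.mul_apply,
    Units.val_mul, mul_inv, smul_smul, mul_div_mul_comm]

/-- The torus acts by `(X_e, Y_e, A_i, B_i) ↦ (X_e / t_e, t_e Y_e / q, A_i, B_i / q)`. -/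
instance : MulAction (Torus I) (StableRep v w) where
  smul τ p :=
    ⟨torusScale τ p.rep, moment_torusScale τ p.moment_eq_zero, isStable_torusScale τ p.stable⟩
  one_smul p := StableRep.ext (torusScale_one p.rep)
  mul_smul τ σ p := StableRep.ext (torusScale_mul τ σ p.rep)

theorem torus_gauge_comm (τ : Torus I) (g : GaugeGroup v) (p : StableRep v w) :
    τ • g • p = g • τ • p := by
  refine StableRep.ext ?_
  change torusScale τ (gaugeAct g p.rep) = gaugeAct g (torusScale τ p.rep)
  refine FramedHom.ext ?_ ?_ rfl rfl
  · funext i j e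
    exact LinearMap.ext fun u => (map_smul (g j).1 _ _).symm
  · funext i j e
    exact LinearMap.ext fun u => (map_smul (g i).1 _ _).symm

variable (v w) in
/-- The points of the Nakajima quiver variety `M_{v,w} = μ⁻¹(0)^s / G_v`. -/
abbrev NakajimaVariety := MulAction.orbitRel.Quotient (GaugeGroup v) (StableRep v w)

/-- The quotient map `μ⁻¹(0)^s → M_{v,w}`. -/
def toVariety (p : StableRep v w) : NakajimaVariety v w := Quotient.mk _ p

theorem toVariety_eq_iff {p p' : StableRep v w} :
    toVariety p' = toVariety p ↔ ∃ g : GaugeGroup v, p' = g • p := by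
  rw [toVariety, toVariety, Quotient.eq]
  change p' ∈ MulAction.orbit _ p ↔ _
  rw [MulAction.mem_orbit_iff]
  exact exists_congr fun g => eq_comm

/-- The torus action on `M_{v,w}`. -/
def torusAct (τ : Torus I) : NakajimaVariety v w → NakajimaVariety v w :=
  Quotient.lift (fun p => toVariety (τ • p)) (by
    intro p' p h
    obtain ⟨g, rfl⟩ := toVariety_eq_iff.1 (Quotient.sound h)
    exact toVariety_eq_iff.2 ⟨g, torus_gauge_comm τ g p⟩)

theorem torusAct_toVariety (τ : Torus I) (p : StableRep v w) :
    torusAct τ (toVariety p) = toVariety (τ • p) := rfl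

/-! ## Tautological bundles -/

/-- The set of representations in the orbit `m`. -/
abbrev OrbitFiber (m : NakajimaVariety v w) := {p : StableRep v w // toVariety p = m}

/-- The fibre at `m` of the tautological bundle `𝒱_i = (μ⁻¹(0)^s × V_i) / G_v`. A vector of the
fibre is given by its values `s p ∈ V_i` at all the representatives `p` of `m`, compatibly with the
action of `G_v`. -/
@[ext]
structure Taut (m : NakajimaVariety v w) (i : I) where
  /-- the value at a representative -/
  val : OrbitFiber m → Std v i
  equivariant : ∀ (p p' : OrbitFiber m) (g : GaugeGroup v), p'.1 = g • p.1 →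
    val p' = (g i).1 (val p)

/-- The fibre of the tautological bundle as a linear subspace of a space of functions. -/
def tautSubmodule (m : NakajimaVariety v w) (i : I) : Submodule ℂ (OrbitFiber m → Std v i) where
  carrier := {s | ∀ (p p' : OrbitFiber m) (g : GaugeGroup v), p'.1 = g • p.1 →
    s p' = (g i).1 (s p)}
  add_mem' hs ht p p' g h := by simp [hs p p' g h, ht p p' g h]
  zero_mem' p p' g h := by simp
  smul_mem' c s hs p p' g h := by simp [hs p p' g h]

/-- The fibre of the tautological bundle as a linear subspace of a space of functions. -/
def tautEquiv (m : NakajimaVariety v w) (i : I) : Taut m i ≃ tautSubmodule m i where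
  toFun s := ⟨s.1, s.2⟩
  invFun s := ⟨s.1, s.2⟩
  left_inv _ := rfl
  right_inv _ := rfl

instance (m : NakajimaVariety v w) (i : I) : AddCommGroup (Taut m i) := (tautEquiv m i).addCommGroup

instance (m : NakajimaVariety v w) (i : I) : Module ℂ (Taut m i) := (tautEquiv m i).module ℂ

@[simp] theorem Taut.add_val {m : NakajimaVariety v w} {i : I} (s t : Taut m i) (p : OrbitFiber m) :
    (s + t).val p = s.val p + t.val p := rfl
@[simp] theorem Taut.smul_val {m : NakajimaVariety v w} {i : I} (c : ℂ) (s : Taut m i)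
    (p : OrbitFiber m) : (c • s).val p = c • s.val p := rfl

/-- Evaluation at a representative identifies the fibre of `𝒱_i` with `V_i = ℂ^{v_i}`. -/
def tautEval (p : StableRep v w) (i : I) : Taut (toVariety p) i ≃ₗ[ℂ] Std v i :=
  LinearEquiv.ofBijective
    { toFun := fun s => s.1 ⟨p, rfl⟩
      map_add' := fun _ _ => rfl
      map_smul' := fun _ _ => rfl } (by
    constructor
    · intro s t h
      refine Taut.ext (funext fun p' => ?_)
      obtain ⟨g, hg⟩ := toVariety_eq_iff.1 p'.2
      rw [s.2 ⟨p, rfl⟩ p' g hg, t.2 ⟨p, rfl⟩ p' g hg]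
      exact congrArg _ h
    · intro u
      have H : ∀ p' : OrbitFiber (toVariety p), ∃ g : GaugeGroup v, p'.1 = g • p :=
        fun p' => toVariety_eq_iff.1 p'.2
      choose γ hγ using H
      have huniq : ∀ (p' : OrbitFiber (toVariety p)) (g : GaugeGroup v),
          p'.1 = g • p → γ p' = g := by
        intro p' g hg
        have h1 : (g⁻¹ * γ p') • p = p := by
          rw [mul_smul, ← hγ p', hg, inv_smul_smul]
        exact (inv_mul_eq_one.1 (gauge_free h1)).symm
      refine ⟨⟨fun p' => (γ p' i).1 u, ?_⟩, ?_⟩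
      · intro p₁ p₂ g hg
        have h1 : γ p₂ = g * γ p₁ := huniq p₂ _ (by rw [mul_smul, ← hγ p₁, hg])
        change (γ p₂ i).1 u = (g i).1 ((γ p₁ i).1 u)
        rw [h1]
        rfl
      · change (γ ⟨p, rfl⟩ i).1 u = u
        rw [huniq ⟨p, rfl⟩ 1 (one_smul _ p).symm]
        rfl)

/-- The framed double quiver representation on the fibres at `m` of the tautological bundles:
the maps `X_e : 𝒱_i → 𝒱_j`, `Y_e : 𝒱_j → 𝒱_i`, `A_i : W_i → 𝒱_i`, `B_i : 𝒱_i → W_i`. -/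
def tautRep (m : NakajimaVariety v w) : FramedRep (Taut m) (Std w) where
  x {i j} e :=
    { toFun := fun s => ⟨fun p => p.1.rep.x e (s.1 p), fun p p' g h => by
        rw [s.2 p p' g h, h]; exact gauge_x g p.1 e _⟩
      map_add' := fun s t => Taut.ext (funext fun p => (p.1.rep.x e).map_add _ _)
      map_smul' := fun c s => Taut.ext (funext fun p => (p.1.rep.x e).map_smul c _) }
  y {i j} e :=
    { toFun := fun s => ⟨fun p => p.1.rep.y e (s.1 p), fun p p' g h => by
        rw [s.2 p p' g h, h]; exact gauge_y g p.1 e _⟩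
      map_add' := fun s t => Taut.ext (funext fun p => (p.1.rep.y e).map_add _ _)
      map_smul' := fun c s => Taut.ext (funext fun p => (p.1.rep.y e).map_smul c _) }
  a i :=
    { toFun := fun u => ⟨fun p => p.1.rep.a i u, fun p p' g h => by
        rw [h]; exact gauge_a g p.1 i u⟩
      map_add' := fun s t => Taut.ext (funext fun p => (p.1.rep.a i).map_add _ _)
      map_smul' := fun c s => Taut.ext (funext fun p => (p.1.rep.a i).map_smul c _) }
  b i :=
    { toFun := fun s => m.out.rep.b i (s.1 ⟨m.out, Quotient.out_eq m⟩)
      map_add' := fun s t => (m.out.rep.b i).map_add _ _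
      map_smul' := fun c s => (m.out.rep.b i).map_smul c _ }

/-- The map `B_i` on the fibre can be computed at any representative. -/
theorem tautRep_b_apply (m : NakajimaVariety v w) (i : I) (s : Taut m i) (p : OrbitFiber m) :
    (tautRep m).b i s = p.1.rep.b i (s.1 p) := by
  change m.out.rep.b i (s.1 ⟨m.out, Quotient.out_eq m⟩) = _
  obtain ⟨g, hg⟩ := toVariety_eq_iff.1 ((Quotient.out_eq m).trans p.2.symm)
  rw [s.2 p ⟨m.out, Quotient.out_eq m⟩ g hg, hg]
  exact gauge_b g p.1 i _

theorem torus_mem (τ : Torus I) {m : NakajimaVariety v w} (p : OrbitFiber m) :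
    toVariety (τ • p.1) = torusAct τ m := by
  rw [← torusAct_toVariety, p.2]

theorem torus_inv_mem (τ : Torus I) {m : NakajimaVariety v w} (p : OrbitFiber (torusAct τ m)) :
    toVariety (τ⁻¹ • p.1) = m := by
  obtain ⟨p, hp⟩ := p
  induction m using Quotient.inductionOn with
  | h p₀ =>
    obtain ⟨g, rfl⟩ := toVariety_eq_iff.1 (hp.trans (torusAct_toVariety τ p₀))
    exact toVariety_eq_iff.2 ⟨g, by rw [torus_gauge_comm, inv_smul_smul]⟩

/-- The action of the torus on the tautological bundle `𝒱_i`, which covers its action on `M_{v,w}`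
and is trivial on the vector space `V_i`. -/
def tautTranslate (τ : Torus I) (m : NakajimaVariety v w) (i : I) :
    Taut m i ≃ₗ[ℂ] Taut (torusAct τ m) i where
  toFun s := ⟨fun p => s.1 ⟨τ⁻¹ • p.1, torus_inv_mem τ p⟩, fun p p' g h =>
    s.2 ⟨τ⁻¹ • p.1, torus_inv_mem τ p⟩ ⟨τ⁻¹ • p'.1, torus_inv_mem τ p'⟩ g (by
      change τ⁻¹ • p'.1 = g • τ⁻¹ • p.1
      rw [h, torus_gauge_comm])⟩
  invFun s := ⟨fun p => s.1 ⟨τ • p.1, torus_mem τ p⟩, fun p p' g h =>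
    s.2 ⟨τ • p.1, torus_mem τ p⟩ ⟨τ • p'.1, torus_mem τ p'⟩ g (by
      change τ • p'.1 = g • τ • p.1
      rw [h, torus_gauge_comm])⟩
  map_add' s t := rfl
  map_smul' c s := rfl
  left_inv s := by
    refine Taut.ext (funext fun p => ?_)
    exact congrArg s.1 (Subtype.ext (inv_smul_smul τ p.1))
  right_inv s := by
    refine Taut.ext (funext fun p => ?_)
    exact congrArg s.1 (Subtype.ext (smul_inv_smul τ p.1))

end Variety

/-! ## The product of two Nakajima quiver varieties as an algebraic variety -/

section Geometry

/-- Polynomial functions on a complex vector space. -/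
def polynomialFunctions (F : Type*) [AddCommGroup F] [Module ℂ F] : Subalgebra ℂ (F → ℂ) :=
  Algebra.adjoin ℂ (Set.range fun l : Module.Dual ℂ F => (l : F → ℂ))

/-- The Zariski topology on a set `Z` embedded by `ι` in a complex vector space. -/
abbrev zariskiTopology {Z F : Type*} [AddCommGroup F] [Module ℂ F] (ι : Z → F) :
    TopologicalSpace Z :=
  TopologicalSpace.generateFrom {S | ∃ P ∈ polynomialFunctions F, S = {z | P (ι z) ≠ 0}}

/-- A function is regular on a subset `S` of a set embedded by `ι` in a complex vector space if
near every point of `S` it is a quotient of two polynomials. -/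
def IsRegularFunctionOn {Z F : Type*} [AddCommGroup F] [Module ℂ F] (ι : Z → F) (S : Set Z)
    (φ : Z → ℂ) : Prop :=
  ∀ z ∈ S, ∃ P ∈ polynomialFunctions F, ∃ D ∈ polynomialFunctions F,
    D (ι z) ≠ 0 ∧ ∀ y ∈ S, D (ι y) ≠ 0 → φ y = P (ι y) / D (ι y)

/-- A map to a vector space is regular if all its coordinates are. -/
def IsRegularMapOn {Z F N : Type*} [AddCommGroup F] [Module ℂ F] [AddCommGroup N] [Module ℂ N]
    (ι : Z → F) (S : Set Z) (φ : Z → N) : Prop :=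
  ∀ l : Module.Dual ℂ N, IsRegularFunctionOn ι S fun z => l (φ z)

variable {I : Type*} [Quiver I] [Fintype I] [∀ i j : I, Fintype (i ⟶ j)]

/-- The points of the product `M_{v,w} × M_{v',w'}`. -/
abbrev Base (v w v' w' : I → ℕ) := NakajimaVariety v w × NakajimaVariety v' w'

variable {v w v' w' : I → ℕ}

/-- The quotient map `μ⁻¹(0)^s × μ'⁻¹(0)^s → M_{v,w} × M_{v',w'}`, by the action of
`G_v × G_{v'}`. -/
def toBase (z : StableRep v w × StableRep v' w') : Base v w v' w' :=
  (toVariety z.1, toVariety z.2)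

/-- The embedding of `μ⁻¹(0)^s × μ'⁻¹(0)^s` in the product of the two affine spaces of framed
double quiver representations. -/
def coords (z : StableRep v w × StableRep v' w') :
    FramedRep (Std v) (Std w) × FramedRep (Std v') (Std w') :=
  (z.1.rep, z.2.rep)

/-- The topology of the variety `M_{v,w} × M_{v',w'}`, which is the geometric quotient of
`μ⁻¹(0)^s × μ'⁻¹(0)^s` by `G_v × G_{v'}`: a set is open if its preimage is Zariski open. -/
abbrev baseTopology : TopologicalSpace (Base v w v' w') :=
  (zariskiTopology coords).coinduced toBase

/-- Regular functions on a subset of the geometric quotient: those that pull back to regular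
functions. -/
def IsRegularOnBase (U : Set (Base v w v' w')) (φ : Base v w v' w' → ℂ) : Prop :=
  IsRegularFunctionOn coords (toBase ⁻¹' U) fun z => φ (toBase z)

/-- A family of vector spaces `E m` over `M_{v,w} × M_{v',w'}` with a notion of regular section over
open subsets (`Reg U σ`: the restriction of `σ` to `U` is regular) is an algebraic vector bundle
of rank `r`: near every point there is a frame of `r` regular sections, such that the regular
sections are the combinations of the frame with regular functions as coefficients. -/
def IsVectorBundle (E : Base v w v' w' → Type*) [∀ m, AddCommGroup (E m)] [∀ m, Module ℂ (E m)]
    (Reg : Set (Base v w v' w') → (∀ m, E m) → Prop) (r : ℤ) : Prop :=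
  ∀ m₀ : Base v w v' w', ∃ n : ℕ, (n : ℤ) = r ∧
    ∃ U : Set (Base v w v' w'), IsOpen[baseTopology] U ∧ m₀ ∈ U ∧ ∃ ε : Fin n → ∀ m, E m,
      (∀ k, Reg U (ε k)) ∧
      (∀ m ∈ U, LinearIndependent ℂ (fun k => ε k m) ∧
        Submodule.span ℂ (Set.range fun k => ε k m) = ⊤) ∧
      ∀ U' ⊆ U, IsOpen[baseTopology] U' → ∀ c : Fin n → Base v w v' w' → ℂ,
        Reg U' (fun m => ∑ k, c k m • ε k m) ↔ ∀ k, IsRegularOnBase U' (c k)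

/-- The fibre at `m` of the bundle `⨁_i Hom(𝒱'_i, 𝒱_i)`; it underlies both `C_{-1}` and `C_1`,
which differ by the torus action. -/
abbrev OuterFiber (m : Base v w v' w') := VertexHom (Taut m.2) (Taut m.1)

/-- The fibre at `m` of the bundle `C_0`. -/
abbrev MiddleFiber (m : Base v w v' w') := FramedHom (Taut m.2) (Std w') (Taut m.1) (Std w)

/-- The map `f : C_{-1} → C_0` on the fibres at `m`. -/
def fiberF (m : Base v w v' w') : OuterFiber m →ₗ[ℂ] MiddleFiber m :=
  complexF (tautRep m.1) (tautRep m.2)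

/-- The map `g : C_0 → C_1` on the fibres at `m`. -/
def fiberG (m : Base v w v' w') : MiddleFiber m →ₗ[ℂ] OuterFiber m :=
  complexG (tautRep m.1) (tautRep m.2)

/-- The fibre at `m` of the middle cohomology `ℰ = Ker g / Im f`. -/
abbrev CohomologyFiber (m : Base v w v' w') := MiddleCohomology (tautRep m.1) (tautRep m.2)

/-- Regularity of a section of `⨁_i Hom(𝒱'_i, 𝒱_i)` over `U`, after pull-back to
`μ⁻¹(0)^s × μ'⁻¹(0)^s`, where the tautological bundles are trivialized. -/
def IsRegularOuter (U : Set (Base v w v' w')) (σ : ∀ m : Base v w v' w', OuterFiber m) : Prop :=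
  IsRegularMapOn coords (toBase ⁻¹' U) fun z =>
    vertexMap (fun i => (tautEval z.1 i).toLinearMap) (fun i => (tautEval z.2 i).symm.toLinearMap)
      (σ (toBase z))

/-- Regularity of a section of `C_0` over `U`. -/
def IsRegularMiddle (U : Set (Base v w v' w')) (σ : ∀ m : Base v w v' w', MiddleFiber m) : Prop :=
  IsRegularMapOn coords (toBase ⁻¹' U) fun z =>
    (framedMap (fun i => (tautEval z.1 i).toLinearMap)
      (fun i => (tautEval z.2 i).symm.toLinearMap) (σ (toBase z)) :
        FramedHom (Std v') (Std w') (Std v) (Std w))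

/-- Regularity of a section of `ℰ` over `U`: locally on `U` it is the class of a regular section
of `C_0` in the kernel of `g`. -/
def IsRegularCohomology (U : Set (Base v w v' w')) (σ : ∀ m : Base v w v' w', CohomologyFiber m) :
    Prop :=
  ∀ m₀ ∈ U, ∃ U' ⊆ U, IsOpen[baseTopology] U' ∧ m₀ ∈ U' ∧ ∃ c : ∀ m : Base v w v' w', MiddleFiber m,
    IsRegularMiddle U' c ∧
      ∀ m ∈ U', ∃ h : c m ∈ LinearMap.ker (complexG (tautRep m.1) (tautRep m.2)),
        σ m = Submodule.Quotient.mk ⟨c m, h⟩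

/-- The section `s = (0, 0, A_i π_i, π_i B'_i)` of `ℰ`. -/
def lociSection (π : ∀ i, Std w' i →ₗ[ℂ] Std w i) (m : Base v w v' w') : CohomologyFiber m :=
  sectionClass π (tautRep m.1) (tautRep m.2)

/-- The diagonal torus action on `M_{v,w} × M_{v',w'}`. -/
def torusActBase (τ : Torus I) (m : Base v w v' w') : Base v w v' w' :=
  (torusAct τ m.1, torusAct τ m.2)

/-- The torus action on `C_{-1} = ⨁_i Hom(𝒱'_i, 𝒱_i)`. -/
def translateNeg (τ : Torus I) (m : Base v w v' w') :
    OuterFiber m →ₗ[ℂ] OuterFiber (torusActBase τ m) :=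
  vertexMap (fun i => (tautTranslate τ m.1 i).toLinearMap)
    (fun i => (tautTranslate τ m.2 i).symm.toLinearMap)

/-- The torus action on `C_0`. -/
def translateMiddle (τ : Torus I) (m : Base v w v' w') :
    MiddleFiber m →ₗ[ℂ] MiddleFiber (torusActBase τ m) :=
  torusScale τ ∘ₗ framedMap (fun i => (tautTranslate τ m.1 i).toLinearMap)
    (fun i => (tautTranslate τ m.2 i).symm.toLinearMap)

/-- The torus action on `C_1 = ⨁_i Hom(q 𝒱'_i, 𝒱_i)`. -/
def translatePos (τ : Torus I) (m : Base v w v' w') :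
    OuterFiber m →ₗ[ℂ] OuterFiber (torusActBase τ m) :=
  LinearMap.lsmul ℂ (OuterFiber (torusActBase τ m)) (τ.1 : ℂ)⁻¹ ∘ₗ translateNeg τ m

end Geometry

/-! ## The forms on `ℤ^I` -/

section Forms

variable {I : Type*} [Quiver I] [Fintype I] [∀ i j : I, Fintype (i ⟶ j)]

/-- The dot product. -/
def dot (a b : I → ℤ) : ℤ := ∑ i, a i * b i

/-- `⟨a, b⟩ = a · b - ∑_{e : i ⟶ j} a_i b_j`. -/
def eulerForm (a b : I → ℤ) : ℤ := dot a b - ∑ i : I, ∑ j : I, ∑ _e : i ⟶ j, a i * b j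

/-- `(a, b) = ⟨a, b⟩ + ⟨b, a⟩`. -/
def symForm (a b : I → ℤ) : ℤ := eulerForm a b + eulerForm b a

end Forms

end

end NakajimaQuiver

/-! Exactness at both ends comes from stability: a collection of subspaces that is invariant under
the representation and contains the images of the framing is everything. The kernels of `ψ` are such
a collection when `f ψ = 0` (`complexF_injective`, stability of the second factor). Dually, for a
functional that kills `Im g`, so are the vectors `u` such that it kills every rank-one map with
values in the line of `u` (`complexG_surjective`, stability of the first factor). Equalizers and
images, used in the same way, give the uniqueness and the surjectivity of `ψ`. The relation `g f ψ =
μ ψ - ψ μ'` makes this a complex, and the class of `s` vanishes iff `s = f ψ` for some `ψ`, which is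
the list of commuting squares.

The bundle statements are checked upstairs, on the product of the stable loci, by means of regular
families of linear maps. Stability also trivializes the tautological bundles: a vector of `V_i` at a
point is a combination of words in the `X`, `Y` applied to the `A`, and the same words at the other
points extend it to a regular equivariant family. A basis therefore extends to an equivariant family
of endomorphisms, which is a frame where its determinants are nonzero (`exists_equivariant_frame`,
`exists_localFrame`). In such a frame `f` and `g` are regular families of maps between fixed spaces.
A splitting of the middle term at one point stays a splitting where determinants do not vanish, and
inverses of regular families are regular by Cramer's rule. This yields regular cycles together with
regular coordinates of cohomology classes (`exists_cohomology_frame`), hence a frame of the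
cohomology; its rank is a dimension count.

Since `f`, `g` and `s` are natural for isomorphisms of representations (`Intertwines`), each fact
can be moved between the tautological fibres, a representative of the orbit, a local frame and a
torus translate. Equivariance is this naturality combined with the scaling behaviour of `f`, `g` and
`s`. -/

namespace NakajimaQuiver

noncomputable section

/-! ### Linear algebra of the complex of two representations. -/

section LinearAlgebra

set_option linter.unusedSectionVars false

variable {I : Type*} [Quiver I]
variable {V' W' V W U' U : I → Type*}
  [∀ i, AddCommGroup (V' i)] [∀ i, Module ℂ (V' i)]
  [∀ i, AddCommGroup (W' i)] [∀ i, Module ℂ (W' i)]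
  [∀ i, AddCommGroup (V i)] [∀ i, Module ℂ (V i)]
  [∀ i, AddCommGroup (W i)] [∀ i, Module ℂ (W i)]
  [∀ i, AddCommGroup (U' i)] [∀ i, Module ℂ (U' i)]
  [∀ i, AddCommGroup (U i)] [∀ i, Module ℂ (U i)]

@[simp] theorem vertexMap_apply (φ : ∀ i, V i →ₗ[ℂ] U i) (φ' : ∀ i, U' i →ₗ[ℂ] V' i)
    (ψ : VertexHom V' V) (i : I) : vertexMap φ φ' ψ i = φ i ∘ₗ ψ i ∘ₗ φ' i := rfl

@[simp] theorem framedMap_x (φ : ∀ i, V i →ₗ[ℂ] U i) (φ' : ∀ i, U' i →ₗ[ℂ] V' i)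
    (c : FramedHom V' W' V W) {i j : I} (e : i ⟶ j) :
    (framedMap φ φ' c).x e = φ j ∘ₗ c.x e ∘ₗ φ' i := rfl

@[simp] theorem framedMap_y (φ : ∀ i, V i →ₗ[ℂ] U i) (φ' : ∀ i, U' i →ₗ[ℂ] V' i)
    (c : FramedHom V' W' V W) {i j : I} (e : i ⟶ j) :
    (framedMap φ φ' c).y e = φ i ∘ₗ c.y e ∘ₗ φ' j := rfl

@[simp] theorem framedMap_a (φ : ∀ i, V i →ₗ[ℂ] U i) (φ' : ∀ i, U' i →ₗ[ℂ] V' i)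
    (c : FramedHom V' W' V W) (i : I) : (framedMap φ φ' c).a i = φ i ∘ₗ c.a i := rfl

@[simp] theorem framedMap_b (φ : ∀ i, V i →ₗ[ℂ] U i) (φ' : ∀ i, U' i →ₗ[ℂ] V' i)
    (c : FramedHom V' W' V W) (i : I) : (framedMap φ φ' c).b i = c.b i ∘ₗ φ' i := rfl

@[simp] theorem complexF_x (p : FramedRep V W) (p' : FramedRep V' W') (ψ : VertexHom V' V)
    {i j : I} (e : i ⟶ j) : (complexF p p' ψ).x e = p.x e ∘ₗ ψ i - ψ j ∘ₗ p'.x e := rfl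

@[simp] theorem complexF_y (p : FramedRep V W) (p' : FramedRep V' W') (ψ : VertexHom V' V)
    {i j : I} (e : i ⟶ j) : (complexF p p' ψ).y e = p.y e ∘ₗ ψ j - ψ i ∘ₗ p'.y e := rfl

@[simp] theorem complexF_a (p : FramedRep V W) (p' : FramedRep V' W') (ψ : VertexHom V' V)
    (i : I) : (complexF p p' ψ).a i = ψ i ∘ₗ p'.a i := rfl

@[simp] theorem complexF_b (p : FramedRep V W) (p' : FramedRep V' W') (ψ : VertexHom V' V)
    (i : I) : (complexF p p' ψ).b i = p.b i ∘ₗ ψ i := rfl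

/-- Extensionality for quadruples, with the vertices of the edges made explicit. -/
theorem FramedHom.ext_edges {c d : FramedHom V' W' V W}
    (hx : ∀ (i j : I) (e : i ⟶ j), c.x e = d.x e) (hy : ∀ (i j : I) (e : i ⟶ j), c.y e = d.y e)
    (ha : ∀ i, c.a i = d.a i) (hb : ∀ i, c.b i = d.b i) : c = d := by
  refine FramedHom.ext ?_ ?_ (funext ha) (funext hb)
  · funext i j e; exact hx i j e
  · funext i j e; exact hy i j e

theorem vertexMap_vertexMap_cancel {φ : ∀ i, V i →ₗ[ℂ] U i} {χ : ∀ i, U i →ₗ[ℂ] V i}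
    {φ' : ∀ i, U' i →ₗ[ℂ] V' i} {χ' : ∀ i, V' i →ₗ[ℂ] U' i}
    (h : ∀ i, χ i ∘ₗ φ i = LinearMap.id) (h' : ∀ i, φ' i ∘ₗ χ' i = LinearMap.id)
    (ψ : VertexHom V' V) : vertexMap χ χ' (vertexMap φ φ' ψ) = ψ := by
  refine funext fun i => ?_
  rw [vertexMap_apply, vertexMap_apply, LinearMap.comp_assoc, LinearMap.comp_assoc, h',
    ← LinearMap.comp_assoc, h, LinearMap.id_comp, LinearMap.comp_id]

theorem framedMap_framedMap_cancel {φ : ∀ i, V i →ₗ[ℂ] U i} {χ : ∀ i, U i →ₗ[ℂ] V i}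
    {φ' : ∀ i, U' i →ₗ[ℂ] V' i} {χ' : ∀ i, V' i →ₗ[ℂ] U' i}
    (h : ∀ i, χ i ∘ₗ φ i = LinearMap.id) (h' : ∀ i, φ' i ∘ₗ χ' i = LinearMap.id)
    (c : FramedHom V' W' V W) : framedMap χ χ' (framedMap φ φ' c) = c := by
  have h1 : ∀ i u, χ i (φ i u) = u := fun i u => LinearMap.congr_fun (h i) u
  have h2 : ∀ i u, φ' i (χ' i u) = u := fun i u => LinearMap.congr_fun (h' i) u
  refine FramedHom.ext_edges ?_ ?_ ?_ ?_ <;> intros <;> ext1 u <;> simp [h1, h2]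

/-- Isomorphisms `V_i ≃ U_i`, `V'_i ≃ U'_i` induce an isomorphism of the spaces of vertex maps. -/
def vertexEquiv (φ : ∀ i, V i ≃ₗ[ℂ] U i) (φ' : ∀ i, V' i ≃ₗ[ℂ] U' i) :
    VertexHom V' V ≃ₗ[ℂ] VertexHom U' U :=
  LinearEquiv.ofLinearMap
    (vertexMap (fun i => (φ i).toLinearMap) fun i => (φ' i).symm.toLinearMap)
    (vertexMap (fun i => (φ i).symm.toLinearMap) fun i => (φ' i).toLinearMap)
    (LinearMap.ext fun ψ => vertexMap_vertexMap_cancel (by simp) (by simp) ψ)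
    (LinearMap.ext fun ψ => vertexMap_vertexMap_cancel (by simp) (by simp) ψ)

/-- Isomorphisms `V_i ≃ U_i`, `V'_i ≃ U'_i` induce an isomorphism of the spaces of quadruples. -/
def framedEquiv (φ : ∀ i, V i ≃ₗ[ℂ] U i) (φ' : ∀ i, V' i ≃ₗ[ℂ] U' i) :
    FramedHom V' W' V W ≃ₗ[ℂ] FramedHom U' W' U W :=
  LinearEquiv.ofLinearMap
    (framedMap (fun i => (φ i).toLinearMap) fun i => (φ' i).symm.toLinearMap)
    (framedMap (fun i => (φ i).symm.toLinearMap) fun i => (φ' i).toLinearMap)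
    (LinearMap.ext fun ψ => framedMap_framedMap_cancel (by simp) (by simp) ψ)
    (LinearMap.ext fun ψ => framedMap_framedMap_cancel (by simp) (by simp) ψ)

/-- A collection of isomorphisms that identifies two framed representations with the same
framing. -/
abbrev Intertwines (p : FramedRep V W) (q : FramedRep U W) (φ : ∀ i, V i ≃ₗ[ℂ] U i) : Prop :=
  IsFramedMorphism (fun _ => LinearMap.id) p q fun i => (φ i).toLinearMap

/-! ### Transport of `f`, `g` and `s` along isomorphisms of representations. -/

section Intertwines

variable {p : FramedRep V W} {q : FramedRep U W} {φ : ∀ i, V i ≃ₗ[ℂ] U i}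

theorem Intertwines.x_apply (h : Intertwines p q φ) {i j : I} (e : i ⟶ j) (u : V i) :
    q.x e (φ i u) = φ j (p.x e u) := LinearMap.congr_fun (h.x_comm i j e) u

theorem Intertwines.y_apply (h : Intertwines p q φ) {i j : I} (e : i ⟶ j) (u : V j) :
    q.y e (φ j u) = φ i (p.y e u) := LinearMap.congr_fun (h.y_comm i j e) u

theorem Intertwines.a_apply (h : Intertwines p q φ) (i : I) (u : W i) :
    q.a i u = φ i (p.a i u) := LinearMap.congr_fun (h.a_comm i) u

theorem Intertwines.b_apply (h : Intertwines p q φ) (i : I) (u : V i) :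
    q.b i (φ i u) = p.b i u := LinearMap.congr_fun (h.b_comm i) u

theorem Intertwines.x_symm_apply (h : Intertwines p q φ) {i j : I} (e : i ⟶ j) (u : U i) :
    (φ j).symm (q.x e u) = p.x e ((φ i).symm u) := by
  rw [LinearEquiv.symm_apply_eq, ← h.x_apply, LinearEquiv.apply_symm_apply]

theorem Intertwines.y_symm_apply (h : Intertwines p q φ) {i j : I} (e : i ⟶ j) (u : U j) :
    (φ i).symm (q.y e u) = p.y e ((φ j).symm u) := by
  rw [LinearEquiv.symm_apply_eq, ← h.y_apply, LinearEquiv.apply_symm_apply]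

theorem Intertwines.a_symm_apply (h : Intertwines p q φ) (i : I) (u : W i) :
    (φ i).symm (q.a i u) = p.a i u := by
  rw [LinearEquiv.symm_apply_eq, h.a_apply]

theorem Intertwines.b_symm_apply (h : Intertwines p q φ) (i : I) (u : U i) :
    q.b i u = p.b i ((φ i).symm u) := by
  rw [← h.b_apply, LinearEquiv.apply_symm_apply]

variable {p' : FramedRep V' W'} {q' : FramedRep U' W'} {φ' : ∀ i, V' i ≃ₗ[ℂ] U' i}

theorem complexF_vertexMap (h : Intertwines p q φ) (h' : Intertwines p' q' φ')
    (ψ : VertexHom V' V) :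
    complexF q q' (vertexMap (fun i => (φ i).toLinearMap) (fun i => (φ' i).symm.toLinearMap) ψ) =
      framedMap (fun i => (φ i).toLinearMap) (fun i => (φ' i).symm.toLinearMap)
        (complexF p p' ψ) := by
  refine FramedHom.ext_edges ?_ ?_ ?_ ?_ <;> intros <;> ext1 u <;>
    simp [h.x_apply, h.y_apply, h.b_apply, h'.x_symm_apply, h'.y_symm_apply, h'.a_symm_apply]

theorem sectionVector_framedMap (h : Intertwines p q φ) (h' : Intertwines p' q' φ')
    (π : ∀ i, W' i →ₗ[ℂ] W i) :
    sectionVector π q q' = framedMap (fun i => (φ i).toLinearMap)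
      (fun i => (φ' i).symm.toLinearMap) (sectionVector π p p') := by
  refine FramedHom.ext_edges ?_ ?_ ?_ ?_ <;> intros <;> ext1 u <;>
    simp [sectionVector, h.a_apply, h'.b_symm_apply]

theorem complexG_framedMap [Fintype I] [∀ i j : I, Fintype (i ⟶ j)]
    (h : Intertwines p q φ) (h' : Intertwines p' q' φ') (c : FramedHom V' W' V W) :
    complexG q q' (framedMap (fun i => (φ i).toLinearMap) (fun i => (φ' i).symm.toLinearMap) c) =
      vertexMap (fun i => (φ i).toLinearMap) (fun i => (φ' i).symm.toLinearMap)
        (complexG p p' c) := by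
  refine funext fun i => LinearMap.ext fun u => ?_
  simp [complexG, h.x_apply, h.y_apply, h.a_apply, h'.x_symm_apply, h'.y_symm_apply,
    h'.b_symm_apply, LinearMap.sum_apply]

end Intertwines

/-! ### Exactness of the complex at its ends -/

/-- If `f ψ = 0`, then `ψ` intertwines the `X` and `Y` and kills the image of `A'`, so the subspaces
`Ker ψ_i` are invariant and contain that image. The `b` component is not needed. -/
theorem complexF_injective {p : FramedRep V W} {p' : FramedRep V' W'} (hp' : IsStable p') :
    Function.Injective (complexF p p') := by
  rw [← LinearMap.ker_eq_bot, LinearMap.ker_eq_bot']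
  intro ψ h
  have hx : ∀ (i j : I) (e : i ⟶ j) u, p.x e (ψ i u) = ψ j (p'.x e u) := fun i j e u =>
    sub_eq_zero.1 (LinearMap.congr_fun (congrArg (fun c => c.x e) h) u)
  have hy : ∀ (i j : I) (e : i ⟶ j) u, p.y e (ψ j u) = ψ i (p'.y e u) := fun i j e u =>
    sub_eq_zero.1 (LinearMap.congr_fun (congrArg (fun c => c.y e) h) u)
  have ha : ∀ i u, ψ i (p'.a i u) = 0 := fun i u =>
    LinearMap.congr_fun (congrArg (fun c => c.a i) h) u
  have key := hp' (fun i => LinearMap.ker (ψ i)) ?_ ?_ ?_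
  · exact funext fun i => LinearMap.ker_eq_top.1 (key i)
  · intro i j e u hu
    rw [LinearMap.mem_ker] at hu ⊢
    rw [← hx, hu, map_zero]
  · intro i j e u hu
    rw [LinearMap.mem_ker] at hu ⊢
    rw [← hy, hu, map_zero]
  · rintro i _ ⟨u, rfl⟩
    exact ha i u

/-- The equalizers of `ψ_i` and `χ_i` are invariant, and they contain `Im A'_i` because both maps
are prescribed there by `A_i π_i`. -/
theorem IsFramedMorphism.ext {p : FramedRep V W} {p' : FramedRep V' W'} (hp' : IsStable p')
    {π : ∀ i, W' i →ₗ[ℂ] W i} {ψ χ : ∀ i, V' i →ₗ[ℂ] V i}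
    (hψ : IsFramedMorphism π p' p ψ) (hχ : IsFramedMorphism π p' p χ) : ψ = χ := by
  have key := hp' (fun i => LinearMap.eqLocus (ψ i) (χ i)) ?_ ?_ ?_
  · exact funext fun i => LinearMap.eqLocus_eq_top.1 (key i)
  · intro i j e u hu
    rw [LinearMap.mem_eqLocus] at hu ⊢
    have h1 := LinearMap.congr_fun (hψ.x_comm i j e) u
    have h2 := LinearMap.congr_fun (hχ.x_comm i j e) u
    simp only [LinearMap.comp_apply] at h1 h2
    rw [← h1, ← h2, hu]
  · intro i j e u hu
    rw [LinearMap.mem_eqLocus] at hu ⊢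
    have h1 := LinearMap.congr_fun (hψ.y_comm i j e) u
    have h2 := LinearMap.congr_fun (hχ.y_comm i j e) u
    simp only [LinearMap.comp_apply] at h1 h2
    rw [← h1, ← h2, hu]
  · rintro i _ ⟨u, rfl⟩
    rw [LinearMap.mem_eqLocus]
    exact (LinearMap.congr_fun (hψ.a_comm i) u).symm.trans (LinearMap.congr_fun (hχ.a_comm i) u)

/-- The images of the `ψ_i` are invariant; they contain `Im A_i = Im A_i π_i = Im ψ_i A'_i` since
`π_i` is onto. -/
theorem IsFramedMorphism.surjective {p : FramedRep V W} {p' : FramedRep V' W'} (hp : IsStable p)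
    {π : ∀ i, W' i →ₗ[ℂ] W i} (hπ : ∀ i, Function.Surjective (π i)) {ψ : ∀ i, V' i →ₗ[ℂ] V i}
    (hψ : IsFramedMorphism π p' p ψ) (i : I) : Function.Surjective (ψ i) := by
  refine LinearMap.range_eq_top.1 (hp (fun i => LinearMap.range (ψ i)) ?_ ?_ ?_ i)
  · rintro i j e _ ⟨u, rfl⟩
    exact ⟨p'.x e u, (LinearMap.congr_fun (hψ.x_comm i j e) u).symm⟩
  · rintro i j e _ ⟨u, rfl⟩
    exact ⟨p'.y e u, (LinearMap.congr_fun (hψ.y_comm i j e) u).symm⟩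
  · rintro i _ ⟨u, rfl⟩
    obtain ⟨u, rfl⟩ := hπ i u
    exact ⟨p'.a i u, (LinearMap.congr_fun (hψ.a_comm i) u).symm⟩

theorem complexF_eq_sectionVector_iff {p : FramedRep V W} {p' : FramedRep V' W'}
    {π : ∀ i, W' i →ₗ[ℂ] W i} {ψ : VertexHom V' V} :
    complexF p p' ψ = sectionVector π p p' ↔ IsFramedMorphism π p' p ψ := by
  constructor
  · intro h
    refine ⟨fun i j e => ?_, fun i j e => ?_, fun i => ?_, fun i => ?_⟩
    · exact sub_eq_zero.1 (congrArg (fun c => c.x e) h)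
    · exact sub_eq_zero.1 (congrArg (fun c => c.y e) h)
    · exact (congrArg (fun c => c.a i) h).symm
    · exact congrArg (fun c => c.b i) h
  · intro h
    exact FramedHom.ext_edges (fun i j e => sub_eq_zero.2 (h.x_comm i j e))
      (fun i j e => sub_eq_zero.2 (h.y_comm i j e)) (fun i => (h.a_comm i).symm) h.b_comm

section Fintype

variable [Fintype I] [∀ i j : I, Fintype (i ⟶ j)]

theorem sectionClass_eq_zero_iff {p : FramedRep V W} {p' : FramedRep V' W'}
    {π : ∀ i, W' i →ₗ[ℂ] W i} :
    sectionClass π p p' = 0 ↔ ∃ ψ, IsFramedMorphism π p' p ψ := by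
  rw [sectionClass, Submodule.Quotient.mk_eq_zero, Submodule.submoduleOf, Submodule.mem_comap]
  exact exists_congr fun ψ => complexF_eq_sectionVector_iff

/-- The mixed terms `X ψ Y'` and `Y ψ X'` cancel, and what remains is `μ ψ - ψ μ'`. -/
theorem complexG_complexF {p : FramedRep V W} {p' : FramedRep V' W'} (hp : moment p = 0)
    (hp' : moment p' = 0) (ψ : VertexHom V' V) : complexG p p' (complexF p p' ψ) = 0 := by
  refine funext fun i => LinearMap.ext fun u => ?_
  have h1 := LinearMap.congr_fun (congrFun hp i) (ψ i u)
  have h2 := congrArg (ψ i) (LinearMap.congr_fun (congrFun hp' i) u)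
  simp only [moment, LinearMap.add_apply, LinearMap.sub_apply, LinearMap.sum_apply,
    LinearMap.comp_apply, Pi.zero_apply, LinearMap.zero_apply, map_zero, map_add, map_sub,
    map_sum] at h1 h2
  -- The zero on the right is replaced by `μ ψ - ψ μ'` written out, which leaves an identity of
  -- sums.
  rw [Pi.zero_apply, LinearMap.zero_apply, ← sub_eq_zero_of_eq (h1.trans h2.symm)]
  simp only [complexG, LinearMap.coe_mk, AddHom.coe_mk, LinearMap.add_apply, LinearMap.sub_apply,
    LinearMap.sum_apply, LinearMap.comp_apply, complexF_x, complexF_y, complexF_a, complexF_b,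
    map_sub, Finset.sum_add_distrib, Finset.sum_sub_distrib]
  abel

/-- The value of a functional on the image of `g`, as a sum over edges and vertices. -/
theorem functional_complexG [DecidableEq I] (ℓ : VertexHom V' V →ₗ[ℂ] ℂ) (p : FramedRep V W)
    (p' : FramedRep V' W') (c : FramedHom V' W' V W) :
    ℓ (complexG p p' c) =
      (∑ i : I, ∑ j : I, ∑ e : i ⟶ j,
        (ℓ (Pi.single j (p.x e ∘ₗ c.y e)) - ℓ (Pi.single i (c.y e ∘ₗ p'.x e)))) +
      (∑ i : I, ∑ j : I, ∑ e : i ⟶ j,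
        (ℓ (Pi.single j (c.x e ∘ₗ p'.y e)) - ℓ (Pi.single i (p.y e ∘ₗ c.x e)))) +
      ∑ i : I, (ℓ (Pi.single i (p.a i ∘ₗ c.b i)) - ℓ (Pi.single i (c.a i ∘ₗ p'.b i))) := by
  have h : ∀ d : VertexHom V' V, ℓ d = ∑ i, (ℓ ∘ₗ LinearMap.single ℂ _ i) (d i) := fun d => by
    conv_lhs => rw [← Finset.univ_sum_single d]
    rw [map_sum]; rfl
  rw [h]
  simp only [complexG, LinearMap.coe_mk, AddHom.coe_mk, map_add, map_sub, map_sum,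
    Finset.sum_add_distrib, Finset.sum_sub_distrib, LinearMap.comp_apply, LinearMap.single_apply]
  -- The sums over incoming edges are reindexed by source and target, so that the contributions of
  -- one edge stand together.
  rw [Finset.sum_comm (f := fun i j => ∑ e : j ⟶ i, ℓ (Pi.single i (p.x e ∘ₗ c.y e))),
    Finset.sum_comm (f := fun i j => ∑ e : j ⟶ i, ℓ (Pi.single i (c.x e ∘ₗ p'.y e)))]
  ring

/-- The sum of a function over all edges, evaluated at a family supported at a single edge. -/
theorem sum_edges_single [DecidableEq I] [∀ i j : I, DecidableEq (i ⟶ j)] {R : Type*}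
    [AddCommMonoid R] {N : I → I → Type*} [∀ i j, Zero (N i j)]
    (F : ∀ i j : I, (i ⟶ j) → N i j → R) (hF : ∀ i j e, F i j e 0 = 0)
    {i₀ j₀ : I} (e₀ : i₀ ⟶ j₀) (n : N i₀ j₀) :
    ∑ i : I, ∑ j : I, ∑ e : i ⟶ j,
      F i j e ((Pi.single i₀ (Pi.single j₀ (Pi.single e₀ n)) : ∀ i j, (i ⟶ j) → N i j) i j e) =
      F i₀ j₀ e₀ n := by
  rw [Finset.sum_eq_single i₀ _ (by simp), Finset.sum_eq_single j₀ _ (by simp),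
    Finset.sum_eq_single e₀ _ (by simp)]
  · simp
  · intro e _ he
    simp [he, hF]
  · intro j _ hj
    refine Finset.sum_eq_zero fun e _ => ?_
    simp [hj, hF]
  · intro i _ hi
    refine Finset.sum_eq_zero fun j _ => Finset.sum_eq_zero fun e _ => ?_
    simp [hi, hF]

theorem comp_smulRight_eq {M N P : Type*} [AddCommGroup M] [Module ℂ M] [AddCommGroup N]
    [Module ℂ N] [AddCommGroup P] [Module ℂ P] (φ : N →ₗ[ℂ] P) (ξ : Module.Dual ℂ M) (u : N) :
    φ ∘ₗ ξ.smulRight u = ξ.smulRight (φ u) := by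
  ext; simp

/-- Dual to the injectivity of `f`, with functionals in place of the trace pairing. A nonzero
functional `ℓ` that vanishes on `Im g` is tested on quadruples with a single nonzero entry of rank
one; the resulting relations make the subspaces `S` invariant. -/
theorem complexG_surjective {p : FramedRep V W} {p' : FramedRep V' W'} (hp : IsStable p)
    [∀ i, Module.Finite ℂ (V' i)] :
    Function.Surjective (complexG p p') := by
  classical
  rw [← LinearMap.range_eq_top]
  by_contra hne
  obtain ⟨ℓ, hℓ, hle⟩ := Submodule.exists_le_ker_of_lt_top _ (lt_top_iff_ne_top.2 hne)
  have hz : ∀ c, ℓ (complexG p p' c) = 0 := fun c => hle ⟨c, rfl⟩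
  -- `S i` consists of the `u` for which `ℓ` kills `ξ ⊗ u` at the vertex `i` for all `ξ`.
  let S : ∀ i, Submodule ℂ (V i) := fun i =>
    { carrier := {u | ∀ ξ : Module.Dual ℂ (V' i), ℓ (Pi.single i (ξ.smulRight u)) = 0}
      add_mem' := fun {u t} hu ht ξ => by
        have : ξ.smulRight (u + t) = ξ.smulRight u + ξ.smulRight t := by ext; simp
        rw [this, Pi.single_add, map_add, hu, ht, add_zero]
      zero_mem' := fun ξ => by
        have : ξ.smulRight (0 : V i) = 0 := by ext; simp
        rw [this, Pi.single_zero, map_zero]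
      smul_mem' := fun t u hu ξ => by
        have : ξ.smulRight (t • u) = t • ξ.smulRight u := by ext; simp [smul_comm t]
        rw [this, Pi.single_smul, map_smul, hu, smul_zero] }
  have key := hp S ?_ ?_ ?_
  · apply hℓ
    refine LinearMap.pi_ext' fun i => LinearMap.ext fun d => ?_
    -- Once `S` is everything, `ℓ = 0`, because rank-one maps span; this is where `V'_i` must be
    -- finite-dimensional.
    have hd : d = ∑ k, (LinearMap.smulRight ((Module.finBasis ℂ (V' i)).coord k)
        (d (Module.finBasis ℂ (V' i) k))) := by
      refine (Module.finBasis ℂ (V' i)).ext fun l => ?_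
      simp [LinearMap.sum_apply, Finsupp.single_apply]
    rw [hd, map_sum]
    refine Finset.sum_eq_zero fun k _ => ?_
    have hm : d (Module.finBasis ℂ (V' i) k) ∈ S i := by rw [key]; trivial
    exact hm _
  · intro i j e u hu ξ
    -- With `y_e = ξ ⊗ u` as the only entry, `ℓ ∘ g = 0` says that `ℓ` agrees on `ξ ⊗ X_e u` at `j`
    -- and on `(ξ X'_e) ⊗ u` at `i`; the latter is killed as `u ∈ S i`. The next case is the same
    -- with the roles of `x` and `y` exchanged.
    have h := hz ⟨fun {_ _} _ => 0, fun {i' j'} e' =>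
      (Pi.single i (Pi.single j (Pi.single e (ξ.smulRight u))) :
        ∀ i j, (i ⟶ j) → (V' j →ₗ[ℂ] V i)) i' j' e', 0, 0⟩
    rw [functional_complexG, sum_edges_single (N := fun i j => V' j →ₗ[ℂ] V i) (fun i j e y =>
      ℓ (Pi.single j (p.x e ∘ₗ y)) - ℓ (Pi.single i (y ∘ₗ p'.x e))) (by simp)] at h
    simp only [LinearMap.comp_zero, LinearMap.zero_comp, Pi.single_zero, map_zero, sub_zero,
      Finset.sum_const_zero, add_zero, Pi.zero_apply] at h
    have h2 := hu (ξ ∘ₗ p'.x e)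
    rw [sub_eq_zero, comp_smulRight_eq] at h
    exact h.trans h2
  · intro i j e u hu ξ
    have h := hz ⟨fun {i' j'} e' =>
      (Pi.single i (Pi.single j (Pi.single e (ξ.smulRight u))) :
        ∀ i j, (i ⟶ j) → (V' i →ₗ[ℂ] V j)) i' j' e', fun {_ _} _ => 0, 0, 0⟩
    rw [functional_complexG, sum_edges_single (N := fun i j => V' i →ₗ[ℂ] V j) (fun i j e x =>
      ℓ (Pi.single j (x ∘ₗ p'.y e)) - ℓ (Pi.single i (p.y e ∘ₗ x))) (by simp)] at h
    simp only [LinearMap.comp_zero, LinearMap.zero_comp, Pi.single_zero, map_zero, sub_zero,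
      Finset.sum_const_zero, add_zero, zero_add, Pi.zero_apply] at h
    have h2 := hu (ξ ∘ₗ p'.y e)
    rw [sub_eq_zero, comp_smulRight_eq] at h
    exact h.symm.trans h2
  · rintro i _ ⟨t, rfl⟩ ξ
    -- With `b_i = ξ ⊗ t` as the only entry, `g` is `ξ ⊗ A_i t` at `i`.
    have h := hz ⟨fun {_ _} _ => 0, fun {_ _} _ => 0, 0, Pi.single i (ξ.smulRight t)⟩
    rw [functional_complexG] at h
    simp only [LinearMap.comp_zero, LinearMap.zero_comp, Pi.single_zero, map_zero, sub_zero,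
      Finset.sum_const_zero, zero_add, Pi.zero_apply] at h
    rw [Finset.sum_eq_single i _ (by simp), Pi.single_eq_same, comp_smulRight_eq] at h
    · exact h
    · intro j _ hj
      simp [Pi.single_eq_of_ne hj]

/-! ### The torus action -/

theorem complexF_torusScale (τ : Torus I) (p : FramedRep V W) (p' : FramedRep V' W')
    (ψ : VertexHom V' V) :
    complexF (torusScale τ p) (torusScale τ p') ψ = torusScale τ (complexF p p' ψ) := by
  refine FramedHom.ext_edges ?_ ?_ ?_ ?_ <;> intros <;> ext1 u <;>
    simp [torusScale, smul_sub]

/-- Each product in `g` pairs an `X`-type factor with a `Y`-type one, or an `A`-type factor with a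
`B`-type one, so the `t_e` cancel and the common weight is `q⁻¹`. This is the twist by `q` in `C_1`.
-/
theorem complexG_torusScale (τ : Torus I) (p : FramedRep V W) (p' : FramedRep V' W')
    (c : FramedHom V' W' V W) :
    complexG (torusScale τ p) (torusScale τ p') (torusScale τ c) =
      (τ.1 : ℂ)⁻¹ • complexG p p' c := by
  have h1 : ∀ i j (e : i ⟶ j), (τ.2 i j e : ℂ)⁻¹ * (τ.2 i j e / τ.1) = (τ.1 : ℂ)⁻¹ :=
    fun i j e => by field_simp
  have h2 : ∀ i j (e : i ⟶ j), ((τ.2 i j e : ℂ) / τ.1) * (τ.2 i j e : ℂ)⁻¹ = (τ.1 : ℂ)⁻¹ :=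
    fun i j e => by field_simp
  refine funext fun i => ?_
  simp only [complexG, torusScale, LinearMap.coe_mk, AddHom.coe_mk, Pi.smul_apply,
    LinearMap.comp_smul, LinearMap.smul_comp, smul_smul, h1, h2, smul_sub, smul_add,
    Finset.smul_sum]

theorem sectionVector_torusScale (τ : Torus I) (π : ∀ i, W' i →ₗ[ℂ] W i) (p : FramedRep V W)
    (p' : FramedRep V' W') :
    sectionVector π (torusScale τ p) (torusScale τ p') = torusScale τ (sectionVector π p p') := by
  refine FramedHom.ext_edges ?_ ?_ ?_ ?_ <;> intros <;> ext1 u <;>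
    simp [torusScale, sectionVector]

theorem torusScale_framedMap (τ : Torus I) (φ : ∀ i, V i →ₗ[ℂ] U i) (φ' : ∀ i, U' i →ₗ[ℂ] V' i)
    (c : FramedHom V' W' V W) :
    torusScale τ (framedMap φ φ' c : FramedHom U' W' U W) = framedMap φ φ' (torusScale τ c) := by
  refine FramedHom.ext_edges ?_ ?_ ?_ ?_ <;> intros <;> ext1 u <;> simp [torusScale]

/-! ### Dimensions -/

/-- Quadruples as elements of a product of spaces of linear maps, as a linear equivalence. -/
def FramedHom.linearEquivProd : FramedHom V' W' V W ≃ₗ[ℂ]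
    (∀ i j : I, (i ⟶ j) → (V' i →ₗ[ℂ] V j)) × (∀ i j : I, (i ⟶ j) → (V' j →ₗ[ℂ] V i)) ×
      (∀ i : I, W' i →ₗ[ℂ] V i) × (∀ i : I, V' i →ₗ[ℂ] W i) :=
  { FramedHom.equivProd with
    map_add' := fun _ _ => rfl
    map_smul' := fun _ _ => rfl }

variable [∀ i, Module.Finite ℂ (V' i)] [∀ i, Module.Finite ℂ (W' i)]
  [∀ i, Module.Finite ℂ (V i)] [∀ i, Module.Finite ℂ (W i)]

instance : Module.Finite ℂ (FramedHom V' W' V W) :=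
  Module.Finite.equiv FramedHom.linearEquivProd.symm

theorem finrank_vertexHom : Module.finrank ℂ (VertexHom V' V) =
    ∑ i, Module.finrank ℂ (V' i) * Module.finrank ℂ (V i) := by
  rw [Module.finrank_pi_fintype]
  simp only [Module.finrank_linearMap]

theorem finrank_framedHom : Module.finrank ℂ (FramedHom V' W' V W) =
    (∑ i : I, ∑ j : I, ∑ _e : i ⟶ j, Module.finrank ℂ (V' i) * Module.finrank ℂ (V j)) +
    ((∑ i : I, ∑ j : I, ∑ _e : i ⟶ j, Module.finrank ℂ (V' j) * Module.finrank ℂ (V i)) +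
    ((∑ i, Module.finrank ℂ (W' i) * Module.finrank ℂ (V i)) +
      ∑ i, Module.finrank ℂ (V' i) * Module.finrank ℂ (W i))) := by
  rw [LinearEquiv.finrank_eq (FramedHom.linearEquivProd (V' := V') (W' := W') (V := V) (W := W))]
  simp only [Module.finrank_prod, Module.finrank_pi_fintype, Module.finrank_linearMap]

end Fintype

/-- The alternating sum of the dimensions of the terms of the complex. -/
theorem finrank_complex [Fintype I] [∀ i j : I, Fintype (i ⟶ j)] (v v' w w' : I → ℕ) :
    (Module.finrank ℂ (FramedHom (Std v') (Std w') (Std v) (Std w)) : ℤ)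
      - 2 * Module.finrank ℂ (VertexHom (Std v') (Std v)) =
      dot (fun i => (w i : ℤ)) (fun i => (v' i : ℤ)) + dot (fun i => (w' i : ℤ)) (fun i => (v i : ℤ))
        - symForm (fun i => (v i : ℤ)) (fun i => (v' i : ℤ)) := by
  rw [finrank_vertexHom, finrank_framedHom]
  simp only [Module.finrank_fin_fun, symForm, eulerForm, dot]
  push_cast
  simp only [mul_comm]
  ring

end LinearAlgebra

end

end NakajimaQuiver

namespace NakajimaQuiver

noncomputable section

/-! ## Regular functions and regular maps -/

section Regular

set_option linter.unusedSectionVars false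

variable {Z F : Type*} [AddCommGroup F] [Module ℂ F] {ι : Z → F} {S : Set Z}

theorem dual_mem_polynomialFunctions (l : Module.Dual ℂ F) : (l : F → ℂ) ∈ polynomialFunctions F :=
  Algebra.subset_adjoin ⟨l, rfl⟩

/-- The nonvanishing loci of polynomials are a basis, not just a subbasis, since an intersection of
two of them is the nonvanishing locus of the product. -/
theorem exists_basicOpen_subset (hS : IsOpen[zariskiTopology ι] S) {z : Z} (hz : z ∈ S) :
    ∃ Q ∈ polynomialFunctions F, Q (ι z) ≠ 0 ∧ ∀ y, Q (ι y) ≠ 0 → y ∈ S := by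
  induction hS with
  | basic T hT =>
    obtain ⟨P, hP, rfl⟩ := hT
    exact ⟨P, hP, hz, fun _ => id⟩
  | univ => exact ⟨1, one_mem _, one_ne_zero, fun _ _ => trivial⟩
  | inter T T' _ _ h h' =>
    obtain ⟨Q, hQ, hQz, hQT⟩ := h hz.1
    obtain ⟨Q', hQ', hQz', hQT'⟩ := h' hz.2
    refine ⟨Q * Q', mul_mem hQ hQ', mul_ne_zero hQz hQz', fun y hy => ?_⟩
    rw [Pi.mul_apply] at hy
    exact ⟨hQT y (left_ne_zero_of_mul hy), hQT' y (right_ne_zero_of_mul hy)⟩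
  | sUnion 𝒯 _ h =>
    obtain ⟨T, hT, hzT⟩ := hz
    obtain ⟨Q, hQ, hQz, hQT⟩ := h T hT hzT
    exact ⟨Q, hQ, hQz, fun y hy => ⟨T, hT, hQT y hy⟩⟩

theorem isOpen_basicOpen {P : F → ℂ} (hP : P ∈ polynomialFunctions F) :
    IsOpen[zariskiTopology ι] {z | P (ι z) ≠ 0} :=
  TopologicalSpace.isOpen_generateFrom_of_mem ⟨P, hP, rfl⟩

theorem isOpen_of_exists_basicOpen (h : ∀ z ∈ S, ∃ Q ∈ polynomialFunctions F, Q (ι z) ≠ 0 ∧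
    ∀ y, Q (ι y) ≠ 0 → y ∈ S) : IsOpen[zariskiTopology ι] S := by
  let := zariskiTopology ι
  refine isOpen_iff_forall_mem_open.2 fun z hz => ?_
  obtain ⟨Q, hQ, hQz, hQS⟩ := h z hz
  exact ⟨_, hQS, isOpen_basicOpen hQ, hQz⟩

namespace IsRegularFunctionOn

variable {φ χ : Z → ℂ}

theorem congr (h : IsRegularFunctionOn ι S φ) (heq : ∀ z ∈ S, χ z = φ z) :
    IsRegularFunctionOn ι S χ := by
  intro z hz
  obtain ⟨P, hP, D, hD, hDz, hPD⟩ := h z hz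
  exact ⟨P, hP, D, hD, hDz, fun y hy hy' => (heq y hy).trans (hPD y hy hy')⟩

theorem mono {S' : Set Z} (h : IsRegularFunctionOn ι S φ) (hS : S' ⊆ S) :
    IsRegularFunctionOn ι S' φ := by
  intro z hz
  obtain ⟨P, hP, D, hD, hDz, hPD⟩ := h z (hS hz)
  exact ⟨P, hP, D, hD, hDz, fun y hy hy' => hPD y (hS hy) hy'⟩

theorem of_local (h : ∀ z ∈ S, ∃ T, IsOpen[zariskiTopology ι] T ∧ z ∈ T ∧
    IsRegularFunctionOn ι T φ) : IsRegularFunctionOn ι S φ := by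
  intro z hz
  obtain ⟨T, hT, hzT, hφ⟩ := h z hz
  obtain ⟨P, hP, D, hD, hDz, hPD⟩ := hφ z hzT
  obtain ⟨Q, hQ, hQz, hQT⟩ := exists_basicOpen_subset hT hzT
  -- The extra factor `Q` confines the nonvanishing locus of the denominator to `T`, where the
  -- fraction is known to represent `φ`.
  refine ⟨P * Q, mul_mem hP hQ, D * Q, mul_mem hD hQ, mul_ne_zero hDz hQz, fun y _ hy => ?_⟩
  rw [Pi.mul_apply] at hy
  rw [Pi.mul_apply, Pi.mul_apply, mul_div_mul_right _ _ (right_ne_zero_of_mul hy)]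
  exact hPD y (hQT y (right_ne_zero_of_mul hy)) (left_ne_zero_of_mul hy)

theorem of_polynomial {P : F → ℂ} (hP : P ∈ polynomialFunctions F) :
    IsRegularFunctionOn ι S fun z => P (ι z) := fun _ _ =>
  ⟨P, hP, 1, one_mem _, one_ne_zero, fun _ _ _ => (div_one _).symm⟩

theorem add (h : IsRegularFunctionOn ι S φ) (h' : IsRegularFunctionOn ι S χ) :
    IsRegularFunctionOn ι S (φ + χ) := by
  intro z hz
  obtain ⟨P, hP, D, hD, hDz, hPD⟩ := h z hz
  obtain ⟨P', hP', D', hD', hDz', hPD'⟩ := h' z hz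
  refine ⟨P * D' + D * P', add_mem (mul_mem hP hD') (mul_mem hD hP'), D * D', mul_mem hD hD',
    mul_ne_zero hDz hDz', fun y hy hy' => ?_⟩
  rw [Pi.mul_apply] at hy'
  have h1 := left_ne_zero_of_mul hy'
  have h2 := right_ne_zero_of_mul hy'
  rw [Pi.add_apply, hPD y hy h1, hPD' y hy h2, div_add_div _ _ h1 h2]
  rfl

theorem mul (h : IsRegularFunctionOn ι S φ) (h' : IsRegularFunctionOn ι S χ) :
    IsRegularFunctionOn ι S (φ * χ) := by
  intro z hz
  obtain ⟨P, hP, D, hD, hDz, hPD⟩ := h z hz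
  obtain ⟨P', hP', D', hD', hDz', hPD'⟩ := h' z hz
  refine ⟨P * P', mul_mem hP hP', D * D', mul_mem hD hD',
    mul_ne_zero hDz hDz', fun y hy hy' => ?_⟩
  rw [Pi.mul_apply] at hy'
  rw [Pi.mul_apply, hPD y hy (left_ne_zero_of_mul hy'), hPD' y hy (right_ne_zero_of_mul hy'),
    div_mul_div_comm]
  rfl

theorem inv (h : IsRegularFunctionOn ι S φ) (h0 : ∀ z ∈ S, φ z ≠ 0) :
    IsRegularFunctionOn ι S fun z => (φ z)⁻¹ := by
  intro z hz
  obtain ⟨P, hP, D, hD, hDz, hPD⟩ := h z hz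
  have hPz : P (ι z) ≠ 0 := fun h1 => h0 z hz (by rw [hPD z hz hDz, h1, zero_div])
  -- `D / P` is expanded by `D` so that a nonzero denominator also ensures `D ≠ 0`, the condition
  -- under which `φ = P / D` is known.
  refine ⟨D * D, mul_mem hD hD, P * D, mul_mem hP hD, mul_ne_zero hPz hDz, fun y hy hy' => ?_⟩
  rw [Pi.mul_apply] at hy'
  have h1 := right_ne_zero_of_mul hy'
  rw [Pi.mul_apply, Pi.mul_apply, mul_div_mul_right _ _ h1, ← inv_div]
  exact congrArg _ (hPD y hy h1)

theorem isOpen_ne_zero (hS : IsOpen[zariskiTopology ι] S) (h : IsRegularFunctionOn ι S φ) :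
    IsOpen[zariskiTopology ι] {z | z ∈ S ∧ φ z ≠ 0} := by
  refine isOpen_of_exists_basicOpen ?_
  rintro z ⟨hz, hφ⟩
  obtain ⟨P, hP, D, hD, hDz, hPD⟩ := h z hz
  obtain ⟨Q, hQ, hQz, hQS⟩ := exists_basicOpen_subset hS hz
  have hPz : P (ι z) ≠ 0 := fun h1 => hφ (by rw [hPD z hz hDz, h1, zero_div])
  refine ⟨P * D * Q, mul_mem (mul_mem hP hD) hQ, mul_ne_zero (mul_ne_zero hPz hDz) hQz,
    fun y hy => ?_⟩
  rw [Pi.mul_apply, Pi.mul_apply] at hy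
  have hy1 := left_ne_zero_of_mul hy
  have hyS := hQS y (right_ne_zero_of_mul hy)
  refine ⟨hyS, ?_⟩
  rw [hPD y hyS (right_ne_zero_of_mul hy1)]
  exact div_ne_zero (left_ne_zero_of_mul hy1) (right_ne_zero_of_mul hy1)

end IsRegularFunctionOn

/-- The algebra of regular functions on `S`. -/
def regularFunctions (ι : Z → F) (S : Set Z) : Subalgebra ℂ (Z → ℂ) where
  carrier := {φ | IsRegularFunctionOn ι S φ}
  add_mem' h h' := h.add h'
  mul_mem' h h' := h.mul h'
  algebraMap_mem' r := IsRegularFunctionOn.of_polynomial (Subalgebra.algebraMap_mem _ r)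

theorem mem_regularFunctions {φ : Z → ℂ} :
    φ ∈ regularFunctions ι S ↔ IsRegularFunctionOn ι S φ := Iff.rfl

theorem isRegularFunctionOn_const (c : ℂ) : IsRegularFunctionOn ι S fun _ => c :=
  (regularFunctions ι S).algebraMap_mem c

theorem isRegularFunctionOn_sum {κ : Type*} (s : Finset κ) {φ : κ → Z → ℂ}
    (h : ∀ k ∈ s, IsRegularFunctionOn ι S (φ k)) :
    IsRegularFunctionOn ι S fun z => ∑ k ∈ s, φ k z := by
  have := (regularFunctions ι S).sum_mem h
  rw [mem_regularFunctions] at this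
  exact this.congr fun z _ => (Finset.sum_apply _ _ _).symm

/-! ### Regular maps -/

variable {N N₁ N₂ N₃ : Type*} [AddCommGroup N] [Module ℂ N] [AddCommGroup N₁] [Module ℂ N₁]
  [AddCommGroup N₂] [Module ℂ N₂] [AddCommGroup N₃] [Module ℂ N₃]

namespace IsRegularMapOn

theorem congr {φ χ : Z → N} (h : IsRegularMapOn ι S φ) (heq : ∀ z ∈ S, χ z = φ z) :
    IsRegularMapOn ι S χ := fun l => (h l).congr fun z hz => by rw [heq z hz]

theorem mono {S' : Set Z} {φ : Z → N} (h : IsRegularMapOn ι S φ) (hS : S' ⊆ S) :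
    IsRegularMapOn ι S' φ := fun l => (h l).mono hS

theorem linear {φ : Z → N} (h : IsRegularMapOn ι S φ) (L : N →ₗ[ℂ] N₁) :
    IsRegularMapOn ι S fun z => L (φ z) := fun l => h (l ∘ₗ L)

/-- Over a field `L` has a linear left inverse. Regularity may thus be tested on matrix entries,
components or values on a basis. -/
theorem of_linear_injective {φ : Z → N} (L : N →ₗ[ℂ] N₁) (hL : Function.Injective L)
    (h : IsRegularMapOn ι S fun z => L (φ z)) : IsRegularMapOn ι S φ := by
  obtain ⟨L', hL'⟩ := L.exists_leftInverse_of_injective (LinearMap.ker_eq_bot.2 hL)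
  refine (h.linear L').congr fun z _ => (LinearMap.congr_fun hL' (φ z)).symm

theorem const (n : N) : IsRegularMapOn ι S fun _ => n := fun l => isRegularFunctionOn_const (l n)

theorem add {φ χ : Z → N} (h : IsRegularMapOn ι S φ) (h' : IsRegularMapOn ι S χ) :
    IsRegularMapOn ι S fun z => φ z + χ z := fun l =>
  ((h l).add (h' l)).congr fun _ _ => map_add l _ _

theorem sum {κ : Type*} (s : Finset κ) {φ : κ → Z → N}
    (h : ∀ k ∈ s, IsRegularMapOn ι S (φ k)) : IsRegularMapOn ι S fun z => ∑ k ∈ s, φ k z :=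
  fun l => (isRegularFunctionOn_sum s fun k hk => h k hk l).congr fun _ _ => map_sum l _ _

theorem smul {φ : Z → ℂ} {χ : Z → N} (h : IsRegularFunctionOn ι S φ)
    (h' : IsRegularMapOn ι S χ) : IsRegularMapOn ι S fun z => φ z • χ z := fun l =>
  (h.mul (h' l)).congr fun _ _ => map_smul l _ _

theorem of_function {φ : Z → ℂ} (h : IsRegularFunctionOn ι S φ) : IsRegularMapOn ι S φ :=
  (smul h (const (1 : ℂ))).congr fun _ _ => (mul_one _).symm

theorem neg {φ : Z → N} (h : IsRegularMapOn ι S φ) : IsRegularMapOn ι S fun z => -φ z :=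
  h.linear (-LinearMap.id)

theorem sub {φ χ : Z → N} (h : IsRegularMapOn ι S φ) (h' : IsRegularMapOn ι S χ) :
    IsRegularMapOn ι S fun z => φ z - χ z :=
  (h.add h'.neg).congr fun _ _ => sub_eq_add_neg _ _

theorem coordinates (L : F →ₗ[ℂ] N) : IsRegularMapOn ι S fun z => L (ι z) := fun l =>
  IsRegularFunctionOn.of_polynomial (dual_mem_polynomialFunctions (l ∘ₗ L))

theorem of_local {φ : Z → N} (h : ∀ z ∈ S, ∃ T, IsOpen[zariskiTopology ι] T ∧ z ∈ T ∧
    IsRegularMapOn ι T φ) : IsRegularMapOn ι S φ := fun l =>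
  IsRegularFunctionOn.of_local fun z hz => by
    obtain ⟨T, hT, hzT, hφ⟩ := h z hz
    exact ⟨T, hT, hzT, hφ l⟩

/-- Expanding the first argument in a basis reduces this to products with regular functions.
Compositions and evaluations of regular families are special cases. -/
theorem bilinear [Module.Finite ℂ N₁] {φ : Z → N₁} {χ : Z → N₂} (h : IsRegularMapOn ι S φ)
    (h' : IsRegularMapOn ι S χ) (B : N₁ →ₗ[ℂ] N₂ →ₗ[ℂ] N₃) :
    IsRegularMapOn ι S fun z => B (φ z) (χ z) := by
  let b := Module.finBasis ℂ N₁
  refine (sum Finset.univ (φ := fun k z => b.coord k (φ z) • B (b k) (χ z)) fun k _ =>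
    smul (h (b.coord k)) (h'.linear (B (b k)))).congr fun z _ => ?_
  have hz := congrArg (fun n => B n (χ z)) (b.sum_repr (φ z))
  simp only [map_sum, map_smul, LinearMap.sum_apply, LinearMap.smul_apply] at hz
  exact hz.symm

theorem comp [Module.Finite ℂ N₁] [Module.Finite ℂ N₂] [Module.Finite ℂ N₃]
    {φ : Z → N₂ →ₗ[ℂ] N₃} {χ : Z → N₁ →ₗ[ℂ] N₂}
    (h : IsRegularMapOn ι S φ) (h' : IsRegularMapOn ι S χ) :
    IsRegularMapOn ι S fun z => φ z ∘ₗ χ z :=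
  h.bilinear h' (LinearMap.llcomp ℂ N₁ N₂ N₃)

theorem apply [Module.Finite ℂ N₁] [Module.Finite ℂ N₂] {φ : Z → N₁ →ₗ[ℂ] N₂} {χ : Z → N₁}
    (h : IsRegularMapOn ι S φ) (h' : IsRegularMapOn ι S χ) :
    IsRegularMapOn ι S fun z => φ z (χ z) :=
  h.bilinear h' LinearMap.id

theorem of_components {κ : Type*} [Finite κ] {M : κ → Type*} [∀ k, AddCommGroup (M k)]
    [∀ k, Module ℂ (M k)] {φ : Z → ∀ k, M k}
    (h : ∀ k, IsRegularMapOn ι S fun z => φ z k) : IsRegularMapOn ι S φ := by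
  classical
  have := Fintype.ofFinite κ
  refine (sum Finset.univ (φ := fun k z => LinearMap.single ℂ M k (φ z k)) fun k _ =>
    (h k).linear _).congr fun z _ => ?_
  exact (Finset.univ_sum_single (φ z)).symm

theorem prodMk {φ : Z → N₁} {χ : Z → N₂} (h : IsRegularMapOn ι S φ)
    (h' : IsRegularMapOn ι S χ) : IsRegularMapOn ι S fun z => (φ z, χ z) :=
  ((h.linear (LinearMap.inl ℂ N₁ N₂)).add (h'.linear (LinearMap.inr ℂ N₁ N₂))).congr
    fun z _ => by simp

theorem of_apply [Module.Finite ℂ N₁] {φ : Z → N₁ →ₗ[ℂ] N₂}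
    (h : ∀ n, IsRegularMapOn ι S fun z => φ z n) : IsRegularMapOn ι S φ := by
  let b := Module.finBasis ℂ N₁
  refine of_linear_injective (b.constr ℂ).symm.toLinearMap (b.constr ℂ).symm.injective ?_
  exact of_components fun k => h (b k)

/-- The matrix of a regular family of endomorphisms has entries in the algebra of regular
functions. -/
theorem exists_matrix [Module.Finite ℂ N] {φ : Z → N →ₗ[ℂ] N} (h : IsRegularMapOn ι S φ) :
    ∃ M : Matrix (Fin (Module.finrank ℂ N)) (Fin (Module.finrank ℂ N)) (regularFunctions ι S),
      ∀ z, LinearMap.toMatrix (Module.finBasis ℂ N) (Module.finBasis ℂ N) (φ z) =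
        ((Pi.evalRingHom (fun _ : Z => ℂ) z).comp
          (regularFunctions ι S).val.toRingHom).mapMatrix M :=
  ⟨fun k l => ⟨fun z => (Module.finBasis ℂ N).coord k (φ z (Module.finBasis ℂ N l)),
    h ((Module.finBasis ℂ N).coord k ∘ₗ LinearMap.applyₗ (Module.finBasis ℂ N l))⟩, fun z => by
    ext k l
    rw [LinearMap.toMatrix_apply]
    rfl⟩

theorem det [Module.Finite ℂ N] {φ : Z → N →ₗ[ℂ] N} (h : IsRegularMapOn ι S φ) :
    IsRegularFunctionOn ι S fun z => LinearMap.det (φ z) := by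
  obtain ⟨M, hM⟩ := h.exists_matrix
  refine IsRegularFunctionOn.congr M.det.2 fun z _ => ?_
  rw [← LinearMap.det_toMatrix (Module.finBasis ℂ N), hM, ← RingHom.map_det]
  rfl

/-- Cramer's rule: the adjugate and the determinant are polynomials in regular entries, and the
determinant has no zero on `S`. -/
theorem leftInverse_end [Module.Finite ℂ N] {φ χ : Z → N →ₗ[ℂ] N} (h : IsRegularMapOn ι S φ)
    (hχ : ∀ z ∈ S, χ z ∘ₗ φ z = LinearMap.id) : IsRegularMapOn ι S χ := by
  obtain ⟨M, hM⟩ := h.exists_matrix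
  let b := Module.finBasis ℂ N
  have hdet : ∀ z ∈ S, LinearMap.det (φ z) ≠ 0 := fun z hz h0 => by
    have := congrArg LinearMap.det (hχ z hz)
    rw [LinearMap.det_comp, h0, mul_zero, LinearMap.det_id] at this
    exact zero_ne_one this
  refine of_linear_injective (LinearMap.toMatrix b b).toLinearMap
    (LinearMap.toMatrix b b).injective ?_
  refine IsRegularMapOn.congr (φ := fun z => (LinearMap.det (φ z))⁻¹ •
    (LinearMap.toMatrix b b (φ z)).adjugate) (smul (h.det.inv hdet) ?_) fun z hz => ?_
  · have hadj : ∀ k l, IsRegularFunctionOn ι S fun z =>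
        (LinearMap.toMatrix b b (φ z)).adjugate k l := fun k l =>
      IsRegularFunctionOn.congr (M.adjugate k l).2 fun z _ => by
        rw [hM, ← RingHom.map_adjugate]
        rfl
    refine of_linear_injective (Matrix.ofLinearEquiv ℂ).symm.toLinearMap
      (Matrix.ofLinearEquiv ℂ).symm.injective ?_
    exact of_components fun k => of_components fun l => of_function (hadj k l)
  · have h1 : LinearMap.toMatrix b b (χ z) * LinearMap.toMatrix b b (φ z) = 1 := by
      rw [← LinearMap.toMatrix_comp, hχ z hz, LinearMap.toMatrix_id]
    have h2 := Matrix.inv_eq_left_inv h1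
    change LinearMap.toMatrix b b (χ z) = _
    rw [← h2, Matrix.inv_def, LinearMap.det_toMatrix, Ring.inverse_eq_inv']

theorem inverse [Module.Finite ℂ N₁] [Module.Finite ℂ N₂] {φ : Z → N₁ →ₗ[ℂ] N₂}
    {χ : Z → N₂ →ₗ[ℂ] N₁} (h : IsRegularMapOn ι S φ)
    (hχ : ∀ z ∈ S, χ z ∘ₗ φ z = LinearMap.id) (hφ : ∀ z ∈ S, φ z ∘ₗ χ z = LinearMap.id) :
    IsRegularMapOn ι S χ := by
  rcases S.eq_empty_or_nonempty with rfl | ⟨z₀, hz₀⟩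
  · exact fun l z hz => hz.elim
  -- The value at one point identifies the two spaces and reduces the claim to families of
  -- endomorphisms.
  · let e : N₁ ≃ₗ[ℂ] N₂ := LinearEquiv.ofLinearMap (φ z₀) (χ z₀) (hφ z₀ hz₀) (hχ z₀ hz₀)
    have h1 : IsRegularMapOn ι S fun z => χ z ∘ₗ e.toLinearMap := by
      refine leftInverse_end ((const e.symm.toLinearMap).comp h) fun z hz => ?_
      ext n
      simpa using LinearMap.congr_fun (hχ z hz) n
    exact (h1.comp (const e.symm.toLinearMap)).congr fun z _ => by ext; simp

/-- After a fixed identification of the two spaces this is the nonvanishing of a regular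
determinant; if they are not isomorphic, the set is empty. -/
theorem isOpen_bijective [Module.Finite ℂ N₁] [Module.Finite ℂ N₂] {φ : Z → N₁ →ₗ[ℂ] N₂}
    (hS : IsOpen[zariskiTopology ι] S) (h : IsRegularMapOn ι S φ) :
    IsOpen[zariskiTopology ι] {z | z ∈ S ∧ Function.Bijective (φ z)} := by
  by_cases hN : Nonempty (N₁ ≃ₗ[ℂ] N₂)
  · obtain ⟨e⟩ := hN
    convert ((const e.symm.toLinearMap).comp h).det.isOpen_ne_zero hS using 1
    ext z
    refine and_congr_right fun _ => ?_
    rw [← isUnit_iff_ne_zero, ← LinearMap.isUnit_iff_isUnit_det, Module.End.isUnit_iff]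
    rw [LinearMap.coe_comp, LinearEquiv.coe_coe, EquivLike.comp_bijective]
  · convert @isOpen_empty _ (zariskiTopology ι) using 1
    refine Set.eq_empty_of_forall_notMem fun z hz => hN ⟨LinearEquiv.ofBijective (φ z) hz.2⟩

end IsRegularMapOn

/-! ### Regular families of quadruples -/

section Framed

variable {I : Type*} [Quiver I] [Fintype I] [∀ i j : I, Fintype (i ⟶ j)]
variable {V' W' V W : I → Type*}
  [∀ i, AddCommGroup (V' i)] [∀ i, Module ℂ (V' i)]
  [∀ i, AddCommGroup (W' i)] [∀ i, Module ℂ (W' i)]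
  [∀ i, AddCommGroup (V i)] [∀ i, Module ℂ (V i)]
  [∀ i, AddCommGroup (W i)] [∀ i, Module ℂ (W i)]

namespace IsRegularMapOn

theorem framed_mk {c : Z → FramedHom V' W' V W}
    (hx : ∀ (i j : I) (e : i ⟶ j), IsRegularMapOn ι S fun z => (c z).x e)
    (hy : ∀ (i j : I) (e : i ⟶ j), IsRegularMapOn ι S fun z => (c z).y e)
    (ha : ∀ i, IsRegularMapOn ι S fun z => (c z).a i)
    (hb : ∀ i, IsRegularMapOn ι S fun z => (c z).b i) : IsRegularMapOn ι S c := by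
  refine of_linear_injective FramedHom.linearEquivProd.toLinearMap
    FramedHom.linearEquivProd.injective ?_
  refine prodMk ?_ (prodMk ?_ (prodMk ?_ ?_))
  · exact of_components fun i => of_components fun j => of_components fun e => hx i j e
  · exact of_components fun i => of_components fun j => of_components fun e => hy i j e
  · exact of_components ha
  · exact of_components hb

theorem framed_x {c : Z → FramedHom V' W' V W} (h : IsRegularMapOn ι S c) {i j : I} (e : i ⟶ j) :
    IsRegularMapOn ι S fun z => (c z).x e :=
  h.linear { toFun := fun c => c.x e, map_add' := fun _ _ => rfl, map_smul' := fun _ _ => rfl }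

theorem framed_y {c : Z → FramedHom V' W' V W} (h : IsRegularMapOn ι S c) {i j : I} (e : i ⟶ j) :
    IsRegularMapOn ι S fun z => (c z).y e :=
  h.linear { toFun := fun c => c.y e, map_add' := fun _ _ => rfl, map_smul' := fun _ _ => rfl }

theorem framed_a {c : Z → FramedHom V' W' V W} (h : IsRegularMapOn ι S c) (i : I) :
    IsRegularMapOn ι S fun z => (c z).a i :=
  h.linear { toFun := fun c => c.a i, map_add' := fun _ _ => rfl, map_smul' := fun _ _ => rfl }

theorem framed_b {c : Z → FramedHom V' W' V W} (h : IsRegularMapOn ι S c) (i : I) :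
    IsRegularMapOn ι S fun z => (c z).b i :=
  h.linear { toFun := fun c => c.b i, map_add' := fun _ _ => rfl, map_smul' := fun _ _ => rfl }

theorem component {κ : Type*} {M : κ → Type*} [∀ k, AddCommGroup (M k)]
    [∀ k, Module ℂ (M k)] {φ : Z → ∀ k, M k} (h : IsRegularMapOn ι S φ) (k : κ) :
    IsRegularMapOn ι S fun z => φ z k :=
  h.linear (LinearMap.proj k)

variable {U' U : I → Type*}
  [∀ i, AddCommGroup (U' i)] [∀ i, Module ℂ (U' i)]
  [∀ i, AddCommGroup (U i)] [∀ i, Module ℂ (U i)]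
  [∀ i, Module.Finite ℂ (V' i)] [∀ i, Module.Finite ℂ (W' i)]
  [∀ i, Module.Finite ℂ (V i)] [∀ i, Module.Finite ℂ (W i)]
  [∀ i, Module.Finite ℂ (U' i)] [∀ i, Module.Finite ℂ (U i)]

theorem vertexMap {φ : Z → ∀ i, V i →ₗ[ℂ] U i} {φ' : Z → ∀ i, U' i →ₗ[ℂ] V' i}
    {ψ : Z → VertexHom V' V} (h : ∀ i, IsRegularMapOn ι S fun z => φ z i)
    (h' : ∀ i, IsRegularMapOn ι S fun z => φ' z i) (hψ : IsRegularMapOn ι S ψ) :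
    IsRegularMapOn ι S fun z => NakajimaQuiver.vertexMap (φ z) (φ' z) (ψ z) :=
  of_components fun i => (h i).comp ((hψ.component i).comp (h' i))

theorem framedMap {φ : Z → ∀ i, V i →ₗ[ℂ] U i} {φ' : Z → ∀ i, U' i →ₗ[ℂ] V' i}
    {c : Z → FramedHom V' W' V W} (h : ∀ i, IsRegularMapOn ι S fun z => φ z i)
    (h' : ∀ i, IsRegularMapOn ι S fun z => φ' z i) (hc : IsRegularMapOn ι S c) :
    IsRegularMapOn ι S fun z => (NakajimaQuiver.framedMap (φ z) (φ' z) (c z) :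
      FramedHom U' W' U W) :=
  framed_mk (fun i j e => (h j).comp ((hc.framed_x e).comp (h' i)))
    (fun i j e => (h i).comp ((hc.framed_y e).comp (h' j)))
    (fun i => (h i).comp (hc.framed_a i)) (fun i => (hc.framed_b i).comp (h' i))

variable {p : Z → FramedRep V W} {p' : Z → FramedRep V' W'}

theorem complexF {ψ : Z → VertexHom V' V} (h : IsRegularMapOn ι S p) (h' : IsRegularMapOn ι S p')
    (hψ : IsRegularMapOn ι S ψ) :
    IsRegularMapOn ι S fun z => NakajimaQuiver.complexF (p z) (p' z) (ψ z) :=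
  framed_mk
    (fun i j e => ((h.framed_x e).comp (hψ.component i)).sub ((hψ.component j).comp (h'.framed_x e)))
    (fun i j e => ((h.framed_y e).comp (hψ.component j)).sub ((hψ.component i).comp (h'.framed_y e)))
    (fun i => (hψ.component i).comp (h'.framed_a i))
    (fun i => (h.framed_b i).comp (hψ.component i))

theorem complexG {c : Z → FramedHom V' W' V W} (h : IsRegularMapOn ι S p)
    (h' : IsRegularMapOn ι S p') (hc : IsRegularMapOn ι S c) :
    IsRegularMapOn ι S fun z => NakajimaQuiver.complexG (p z) (p' z) (c z) :=
  of_components fun i =>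
    ((sum _ fun _ _ => sum _ fun e _ => ((h.framed_x e).comp (hc.framed_y e)).add
        ((hc.framed_x e).comp (h'.framed_y e))).sub
      (sum _ fun _ _ => sum _ fun e _ => ((h.framed_y e).comp (hc.framed_x e)).add
        ((hc.framed_y e).comp (h'.framed_x e)))).add
      (((h.framed_a i).comp (hc.framed_b i)).sub ((hc.framed_a i).comp (h'.framed_b i)))

theorem sectionVector (π : ∀ i, W' i →ₗ[ℂ] W i) (h : IsRegularMapOn ι S p)
    (h' : IsRegularMapOn ι S p') :
    IsRegularMapOn ι S fun z => NakajimaQuiver.sectionVector π (p z) (p' z) :=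
  framed_mk (fun _ _ _ => const 0) (fun _ _ _ => const 0)
    (fun i => (h.framed_a i).comp (const (π i))) (fun i => (const (π i)).comp (h'.framed_b i))

end IsRegularMapOn

end Framed

end Regular

end

end NakajimaQuiver

namespace NakajimaQuiver

noncomputable section

/-! ## Changes of frame -/

section ChangeOfFrame

variable {I : Type*} [Quiver I]
variable {V' W' V W U' U N' N : I → Type*}
  [∀ i, AddCommGroup (V' i)] [∀ i, Module ℂ (V' i)]
  [∀ i, AddCommGroup (W' i)] [∀ i, Module ℂ (W' i)]
  [∀ i, AddCommGroup (V i)] [∀ i, Module ℂ (V i)]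
  [∀ i, AddCommGroup (W i)] [∀ i, Module ℂ (W i)]
  [∀ i, AddCommGroup (U' i)] [∀ i, Module ℂ (U' i)]
  [∀ i, AddCommGroup (U i)] [∀ i, Module ℂ (U i)]
  [∀ i, AddCommGroup (N' i)] [∀ i, Module ℂ (N' i)]
  [∀ i, AddCommGroup (N i)] [∀ i, Module ℂ (N i)]
  (α : ∀ i, N i ≃ₗ[ℂ] V i) (α' : ∀ i, N' i ≃ₗ[ℂ] V' i)
  (e : ∀ i, V i ≃ₗ[ℂ] U i) (e' : ∀ i, V' i ≃ₗ[ℂ] U' i)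

/-- Here `α` is to be a local frame and `e` the evaluation at a representative. The lemmas of this
section express one set of coordinates through the other by the transition maps `e ∘ α` and their
inverses only, which are the maps known to be regular. -/
theorem vertexEquiv_symm_eq (σ : VertexHom V' V) :
    (vertexEquiv α α').symm σ =
      vertexMap (fun i => (α i).symm.toLinearMap ∘ₗ (e i).symm.toLinearMap)
        (fun i => (e' i).toLinearMap ∘ₗ (α' i).toLinearMap)
        (vertexMap (fun i => (e i).toLinearMap) (fun i => (e' i).symm.toLinearMap) σ) := by
  refine funext fun i => LinearMap.ext fun u => ?_
  simp [vertexEquiv]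

theorem vertexMap_eq_vertexEquiv_symm (σ : VertexHom V' V) :
    vertexMap (fun i => (e i).toLinearMap) (fun i => (e' i).symm.toLinearMap) σ =
      vertexMap (fun i => (e i).toLinearMap ∘ₗ (α i).toLinearMap)
        (fun i => (α' i).symm.toLinearMap ∘ₗ (e' i).symm.toLinearMap)
        ((vertexEquiv α α').symm σ) := by
  refine funext fun i => LinearMap.ext fun u => ?_
  simp [vertexEquiv]

theorem framedEquiv_symm_eq (σ : FramedHom V' W' V W) :
    (framedEquiv α α').symm σ =
      framedMap (fun i => (α i).symm.toLinearMap ∘ₗ (e i).symm.toLinearMap)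
        (fun i => (e' i).toLinearMap ∘ₗ (α' i).toLinearMap)
        (framedMap (fun i => (e i).toLinearMap) (fun i => (e' i).symm.toLinearMap) σ) := by
  refine FramedHom.ext_edges ?_ ?_ ?_ ?_ <;> intros <;> ext1 u <;> simp [framedEquiv]

theorem framedMap_eq_framedEquiv_symm (σ : FramedHom V' W' V W) :
    framedMap (fun i => (e i).toLinearMap) (fun i => (e' i).symm.toLinearMap) σ =
      framedMap (fun i => (e i).toLinearMap ∘ₗ (α i).toLinearMap)
        (fun i => (α' i).symm.toLinearMap ∘ₗ (e' i).symm.toLinearMap)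
        ((framedEquiv α α').symm σ) := by
  refine FramedHom.ext_edges ?_ ?_ ?_ ?_ <;> intros <;> ext1 u <;> simp [framedEquiv]

variable {e} in
theorem Intertwines.framedMap_symm_eq {p : FramedRep V W} {q : FramedRep U W}
    (h : Intertwines p q e) :
    framedMap (fun i => (α i).symm.toLinearMap) (fun i => (α i).toLinearMap) p =
      framedMap (fun i => (α i).symm.toLinearMap ∘ₗ (e i).symm.toLinearMap)
        (fun i => (e i).toLinearMap ∘ₗ (α i).toLinearMap) q := by
  refine FramedHom.ext_edges ?_ ?_ ?_ ?_ <;> intros <;> ext1 u <;>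
    simp [h.x_symm_apply, h.y_symm_apply, h.a_symm_apply, h.b_apply]

end ChangeOfFrame

/-! ## Local frames of the tautological bundles -/

section Frames

set_option linter.unusedSectionVars false

variable {I : Type*} [Quiver I] [Fintype I] [∀ i j : I, Fintype (i ⟶ j)]
variable {v w v' w' : I → ℕ}

theorem intertwines_tautEval (p : StableRep v w) :
    Intertwines (tautRep (toVariety p)) p.rep (tautEval p) :=
  ⟨fun _ _ _ => rfl, fun _ _ _ => rfl, fun _ => rfl,
    fun i => LinearMap.ext fun s => (tautRep_b_apply (toVariety p) i s ⟨p, rfl⟩).symm⟩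

section Equivariant

variable {Z F : Type*} [AddCommGroup F] [Module ℂ F] {ι : Z → F} {pr : Z → StableRep v w}

/-- Every vector of `V_i` is a value of a regular `G_v`-equivariant function on the stable locus:
by stability it is obtained from the images of the maps `A_j` by the maps `X_e` and `Y_e`. -/
theorem exists_equivariant_vector (hpr : IsRegularMapOn ι Set.univ fun z => (pr z).rep)
    (p₀ : StableRep v w) (i : I) (u : Std v i) :
    ∃ s : StableRep v w → Std v i, (∀ (g : GaugeGroup v) p, s (g • p) = (g i).1 (s p)) ∧
      IsRegularMapOn ι Set.univ (fun z => s (pr z)) ∧ s p₀ = u := by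
  let T : ∀ i, Submodule ℂ (Std v i) := fun i =>
    { carrier := {u | ∃ s : StableRep v w → Std v i,
        (∀ (g : GaugeGroup v) p, s (g • p) = (g i).1 (s p)) ∧
        IsRegularMapOn ι Set.univ (fun z => s (pr z)) ∧ s p₀ = u}
      add_mem' := by
        rintro _ _ ⟨s, hs, hsr, rfl⟩ ⟨t, ht, htr, rfl⟩
        exact ⟨fun p => s p + t p, fun g p => by simp only [hs, ht, map_add], hsr.add htr, rfl⟩
      zero_mem' := ⟨fun _ => 0, fun g p => (map_zero _).symm, IsRegularMapOn.const 0, rfl⟩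
      smul_mem' := by
        rintro c _ ⟨s, hs, hsr, rfl⟩
        exact ⟨fun p => c • s p, fun g p => by simp only [hs, map_smul],
          IsRegularMapOn.smul (isRegularFunctionOn_const c) hsr, rfl⟩ }
  have key := p₀.stable T ?_ ?_ ?_ i
  · have hu : u ∈ T i := by rw [key]; trivial
    exact hu
  · rintro i j e _ ⟨s, hs, hsr, rfl⟩
    exact ⟨fun p => p.rep.x e (s p), fun g p => by simp only [hs, gauge_x],
      (hpr.framed_x e).apply hsr, rfl⟩
  · rintro i j e _ ⟨s, hs, hsr, rfl⟩
    exact ⟨fun p => p.rep.y e (s p), fun g p => by simp only [hs, gauge_y],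
      (hpr.framed_y e).apply hsr, rfl⟩
  · rintro i _ ⟨t, rfl⟩
    exact ⟨fun p => p.rep.a i t, fun g p => gauge_a g p i t,
      (hpr.framed_a i).apply (IsRegularMapOn.const t), rfl⟩

/-- The columns of `γ` are equivariant families through the standard basis vectors at `p₀`.
Equivariance lets `γ` descend to sections of the tautological bundle, so local triviality requires
no slice or descent theorem. -/
theorem exists_equivariant_frame (hpr : IsRegularMapOn ι Set.univ fun z => (pr z).rep)
    (p₀ : StableRep v w) :
    ∃ γ : StableRep v w → ∀ i, Std v i →ₗ[ℂ] Std v i,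
      (∀ (g : GaugeGroup v) p i u, γ (g • p) i u = (g i).1 (γ p i u)) ∧
      (∀ i, IsRegularMapOn ι Set.univ fun z => γ (pr z) i) ∧ ∀ i, γ p₀ i = LinearMap.id := by
  choose s hs hsr hs0 using fun i (k : Fin (v i)) =>
    exists_equivariant_vector hpr p₀ i (Pi.basisFun ℂ (Fin (v i)) k)
  refine ⟨fun p i => (Pi.basisFun ℂ (Fin (v i))).constr ℂ fun k => s i k p, ?_, ?_, ?_⟩
  · intro g p i u
    simp [Module.Basis.constr_apply_fintype, hs, map_sum]
  · intro i
    exact (IsRegularMapOn.of_components (φ := fun z k => s i k (pr z)) (hsr i)).linear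
      ((Pi.basisFun ℂ (Fin (v i))).constr ℂ).toLinearMap
  · intro i
    refine (Pi.basisFun ℂ (Fin (v i))).ext fun k => ?_
    rw [Module.Basis.constr_basis, hs0, LinearMap.id_apply]

end Equivariant

/-- The vectors of the tautological bundle given by an equivariant family of endomorphisms. -/
def tautFrame (γ : StableRep v w → ∀ i, Std v i →ₗ[ℂ] Std v i)
    (hγ : ∀ (g : GaugeGroup v) p i u, γ (g • p) i u = (g i).1 (γ p i u))
    (m : NakajimaVariety v w) (i : I) : Std v i →ₗ[ℂ] Taut m i where
  toFun u := ⟨fun p => γ p.1 i u, fun p p' g h => by rw [h, hγ]⟩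
  map_add' u t := Taut.ext (funext fun p => map_add (γ p.1 i) u t)
  map_smul' c u := Taut.ext (funext fun p => map_smul (γ p.1 i) c u)

theorem tautEval_comp_tautFrame (γ : StableRep v w → ∀ i, Std v i →ₗ[ℂ] Std v i)
    (hγ : ∀ (g : GaugeGroup v) p i u, γ (g • p) i u = (g i).1 (γ p i u))
    (p : StableRep v w) (i : I) :
    (tautEval p i).toLinearMap ∘ₗ tautFrame γ hγ (toVariety p) i = γ p i := rfl

theorem nonempty_taut_equiv (m : NakajimaVariety v w) (i : I) :
    Nonempty (Std v i ≃ₗ[ℂ] Taut m i) := by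
  induction m using Quotient.inductionOn with
  | h p => exact ⟨(tautEval p i).symm⟩

theorem isRegular_fst {S : Set (StableRep v w × StableRep v' w')} :
    IsRegularMapOn coords S fun z => z.1.rep :=
  IsRegularMapOn.coordinates (ι := coords)
    (LinearMap.fst ℂ (FramedRep (Std v) (Std w)) (FramedRep (Std v') (Std w')))

theorem isRegular_snd {S : Set (StableRep v w × StableRep v' w')} :
    IsRegularMapOn coords S fun z => z.2.rep :=
  IsRegularMapOn.coordinates (ι := coords)
    (LinearMap.snd ℂ (FramedRep (Std v) (Std w)) (FramedRep (Std v') (Std w')))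

theorem toBase_surjective : Function.Surjective (toBase (v := v) (w := w) (v' := v') (w' := w')) := by
  rintro ⟨m, m'⟩
  obtain ⟨p, rfl⟩ := Quotient.exists_rep m
  obtain ⟨p', rfl⟩ := Quotient.exists_rep m'
  exact ⟨(p, p'), rfl⟩

theorem isOpen_base_iff {U : Set (Base v w v' w')} :
    IsOpen[baseTopology] U ↔ IsOpen[zariskiTopology coords] (toBase ⁻¹' U) := Iff.rfl

variable (v w v' w') in
/-- Isomorphisms of the fibres of the tautological bundles with the standard vector spaces, regular
over an open subset of the base. -/
structure LocalFrame where
  /-- the open set over which the isomorphisms are regular -/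
  dom : Set (Base v w v' w')
  isOpen_dom : IsOpen[baseTopology] dom
  /-- the isomorphisms for the first factor -/
  fst : ∀ (m : Base v w v' w') (i : I), Std v i ≃ₗ[ℂ] Taut m.1 i
  /-- the isomorphisms for the second factor -/
  snd : ∀ (m : Base v w v' w') (i : I), Std v' i ≃ₗ[ℂ] Taut m.2 i
  regular_fst : ∀ i, IsRegularMapOn coords (toBase ⁻¹' dom) fun z =>
    (tautEval z.1 i).toLinearMap ∘ₗ (fst (toBase z) i).toLinearMap
  regular_snd : ∀ i, IsRegularMapOn coords (toBase ⁻¹' dom) fun z =>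
    (tautEval z.2 i).toLinearMap ∘ₗ (snd (toBase z) i).toLinearMap

theorem exists_localFrame (m₀ : Base v w v' w') :
    ∃ L : LocalFrame v w v' w', m₀ ∈ L.dom := by
  classical
  obtain ⟨z₀, rfl⟩ := toBase_surjective m₀
  obtain ⟨γ, hγ, hγr, hγ0⟩ := exists_equivariant_frame
    (ι := coords (v := v) (w := w) (v' := v') (w' := w')) isRegular_fst z₀.1
  obtain ⟨γ', hγ', hγr', hγ0'⟩ := exists_equivariant_frame
    (ι := coords (v := v) (w := w) (v' := v') (w' := w')) isRegular_snd z₀.2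
  -- Bijectivity is a condition on the orbit, as evaluation at any representative is an isomorphism;
  -- upstairs it is an open condition on `γ` and `γ'`.
  let D : Set (Base v w v' w') := {m | (∀ i, Function.Bijective (tautFrame γ hγ m.1 i)) ∧
    ∀ i, Function.Bijective (tautFrame γ' hγ' m.2 i)}
  have hb : ∀ (z : StableRep v w × StableRep v' w') i,
      Function.Bijective (tautFrame γ hγ (toBase z).1 i) ↔ Function.Bijective (γ z.1 i) := by
    intro z i
    rw [← tautEval_comp_tautFrame γ hγ, LinearMap.coe_comp, LinearEquiv.coe_coe,
      EquivLike.comp_bijective]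
    rfl
  have hb' : ∀ (z : StableRep v w × StableRep v' w') i,
      Function.Bijective (tautFrame γ' hγ' (toBase z).2 i) ↔ Function.Bijective (γ' z.2 i) := by
    intro z i
    rw [← tautEval_comp_tautFrame γ' hγ', LinearMap.coe_comp, LinearEquiv.coe_coe,
      EquivLike.comp_bijective]
    rfl
  have hD : IsOpen[baseTopology] D := by
    let := zariskiTopology (coords (v := v) (w := w) (v' := v') (w' := w'))
    have h : toBase ⁻¹' D = (⋂ i, {z | z ∈ Set.univ ∧ Function.Bijective (γ z.1 i)}) ∩
        ⋂ i, {z | z ∈ Set.univ ∧ Function.Bijective (γ' z.2 i)} := by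
      ext z
      simp only [D, Set.mem_preimage, Set.mem_ofPred_eq, Set.mem_inter_iff, Set.mem_iInter, hb, hb',
        Set.mem_univ, true_and]
    rw [isOpen_base_iff, h]
    exact (isOpen_iInter_of_finite fun i => (hγr i).isOpen_bijective isOpen_univ).inter
      (isOpen_iInter_of_finite fun i => (hγr' i).isOpen_bijective isOpen_univ)
  refine ⟨⟨D, hD,
    -- A `LocalFrame` has isomorphisms at all points; outside `D` they are arbitrary, and nothing is
    -- claimed about them there.
    fun m i => if h : Function.Bijective (tautFrame γ hγ m.1 i) then LinearEquiv.ofBijective _ h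
      else (nonempty_taut_equiv m.1 i).some,
    fun m i => if h : Function.Bijective (tautFrame γ' hγ' m.2 i) then LinearEquiv.ofBijective _ h
      else (nonempty_taut_equiv m.2 i).some, fun i => ?_, fun i => ?_⟩, ?_⟩
  · refine ((hγr i).mono (Set.subset_univ _)).congr fun z hz => ?_
    rw [dif_pos (hz.1 i)]
    rfl
  · refine ((hγr' i).mono (Set.subset_univ _)).congr fun z hz => ?_
    rw [dif_pos (hz.2 i)]
    rfl
  · constructor
    · intro i
      rw [hb, hγ0]
      exact Function.bijective_id
    · intro i
      rw [hb', hγ0']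
      exact Function.bijective_id

namespace LocalFrame

variable (L : LocalFrame v w v' w')

theorem regular_fst_symm (i : I) : IsRegularMapOn coords (toBase ⁻¹' L.dom) fun z =>
    (L.fst (toBase z) i).symm.toLinearMap ∘ₗ (tautEval z.1 i).symm.toLinearMap :=
  (L.regular_fst i).inverse
    (fun z _ => LinearMap.ext fun u => by
      simp only [LinearMap.comp_apply, LinearMap.id_apply]
      exact (congrArg _ ((tautEval z.1 i).symm_apply_apply _)).trans
        ((L.fst (toBase z) i).symm_apply_apply u))
    (fun z _ => LinearMap.ext fun u => by
      simp only [LinearMap.comp_apply, LinearMap.id_apply]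
      exact (congrArg _ ((L.fst (toBase z) i).apply_symm_apply _)).trans
        ((tautEval z.1 i).apply_symm_apply u))

theorem regular_snd_symm (i : I) : IsRegularMapOn coords (toBase ⁻¹' L.dom) fun z =>
    (L.snd (toBase z) i).symm.toLinearMap ∘ₗ (tautEval z.2 i).symm.toLinearMap :=
  (L.regular_snd i).inverse
    (fun z _ => LinearMap.ext fun u => by
      simp only [LinearMap.comp_apply, LinearMap.id_apply]
      exact (congrArg _ ((tautEval z.2 i).symm_apply_apply _)).trans
        ((L.snd (toBase z) i).symm_apply_apply u))
    (fun z _ => LinearMap.ext fun u => by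
      simp only [LinearMap.comp_apply, LinearMap.id_apply]
      exact (congrArg _ ((L.snd (toBase z) i).apply_symm_apply _)).trans
        ((tautEval z.2 i).apply_symm_apply u))

/-- The induced trivialization of `⨁_i Hom(𝒱'_i, 𝒱_i)`. -/
def outer (m : Base v w v' w') : VertexHom (Std v') (Std v) ≃ₗ[ℂ] OuterFiber m :=
  vertexEquiv (L.fst m) (L.snd m)

/-- The induced trivialization of `C_0`. -/
def middle (m : Base v w v' w') :
    FramedHom (Std v') (Std w') (Std v) (Std w) ≃ₗ[ℂ] MiddleFiber m :=
  framedEquiv (L.fst m) (L.snd m)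

theorem isRegularOuter_iff {U : Set (Base v w v' w')} (hU : U ⊆ L.dom)
    {σ : ∀ m : Base v w v' w', OuterFiber m} :
    IsRegularOuter U σ ↔ IsRegularMapOn coords (toBase ⁻¹' U) fun z =>
      (L.outer (toBase z)).symm (σ (toBase z)) := by
  have hU' : toBase ⁻¹' U ⊆ toBase ⁻¹' L.dom := Set.preimage_mono hU
  constructor
  · intro h
    exact (h.vertexMap (fun i => (L.regular_fst_symm i).mono hU')
      (fun i => (L.regular_snd i).mono hU')).congr fun z _ =>
        vertexEquiv_symm_eq (L.fst (toBase z)) (L.snd (toBase z)) (tautEval z.1) (tautEval z.2) _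
  · intro h
    exact (h.vertexMap (fun i => (L.regular_fst i).mono hU')
      (fun i => (L.regular_snd_symm i).mono hU')).congr fun z _ =>
        vertexMap_eq_vertexEquiv_symm (L.fst (toBase z)) (L.snd (toBase z)) (tautEval z.1)
          (tautEval z.2) _

theorem isRegularMiddle_iff {U : Set (Base v w v' w')} (hU : U ⊆ L.dom)
    {σ : ∀ m : Base v w v' w', MiddleFiber m} :
    IsRegularMiddle U σ ↔ IsRegularMapOn coords (toBase ⁻¹' U) fun z =>
      (L.middle (toBase z)).symm (σ (toBase z)) := by
  have hU' : toBase ⁻¹' U ⊆ toBase ⁻¹' L.dom := Set.preimage_mono hU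
  constructor
  · intro h
    exact (h.framedMap (fun i => (L.regular_fst_symm i).mono hU')
      (fun i => (L.regular_snd i).mono hU')).congr fun z _ =>
        framedEquiv_symm_eq (L.fst (toBase z)) (L.snd (toBase z)) (tautEval z.1) (tautEval z.2) _
  · intro h
    exact (h.framedMap (fun i => (L.regular_fst i).mono hU')
      (fun i => (L.regular_snd_symm i).mono hU')).congr fun z _ =>
        framedMap_eq_framedEquiv_symm (L.fst (toBase z)) (L.snd (toBase z)) (tautEval z.1)
          (tautEval z.2) _

/-- The representation on the first tautological bundle in a local frame. -/
def repFst (m : Base v w v' w') : FramedRep (Std v) (Std w) :=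
  framedMap (fun i => (L.fst m i).symm.toLinearMap) (fun i => (L.fst m i).toLinearMap)
    (tautRep m.1)

/-- The representation on the second tautological bundle in a local frame. -/
def repSnd (m : Base v w v' w') : FramedRep (Std v') (Std w') :=
  framedMap (fun i => (L.snd m i).symm.toLinearMap) (fun i => (L.snd m i).toLinearMap)
    (tautRep m.2)

theorem intertwines_fst (m : Base v w v' w') :
    Intertwines (L.repFst m) (tautRep m.1) (L.fst m) := by
  refine ⟨fun i j e => ?_, fun i j e => ?_, fun i => ?_, fun i => ?_⟩ <;> ext1 u <;> simp [repFst]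

theorem intertwines_snd (m : Base v w v' w') :
    Intertwines (L.repSnd m) (tautRep m.2) (L.snd m) := by
  refine ⟨fun i j e => ?_, fun i j e => ?_, fun i => ?_, fun i => ?_⟩ <;> ext1 u <;> simp [repSnd]

/-- Seen at `z`, the representation in the frame is `z.1.rep` conjugated by the regular transition
maps. -/
theorem regular_repFst : IsRegularMapOn coords (toBase ⁻¹' L.dom) fun z =>
    L.repFst (toBase z) := by
  exact ((isRegular_fst (v' := v') (w' := w')).framedMap L.regular_fst_symm
    L.regular_fst).congr fun z _ =>
      (intertwines_tautEval z.1).framedMap_symm_eq (L.fst (toBase z))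

theorem regular_repSnd : IsRegularMapOn coords (toBase ⁻¹' L.dom) fun z =>
    L.repSnd (toBase z) := by
  exact ((isRegular_snd (v := v) (w := w)).framedMap L.regular_snd_symm
    L.regular_snd).congr fun z _ =>
      (intertwines_tautEval z.2).framedMap_symm_eq (L.snd (toBase z))

end LocalFrame

end Frames

end

end NakajimaQuiver

namespace NakajimaQuiver

noncomputable section

/-! ## Bases of the cohomology of a complex -/

section Splitting

variable {A B C : Type*} [AddCommGroup A] [Module ℂ A] [AddCommGroup B] [Module ℂ B]
  [AddCommGroup C] [Module ℂ C]

/-- A splitting of the middle term of a complex that is exact at its ends. -/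
theorem exists_splitting [Module.Finite ℂ B] {f : A →ₗ[ℂ] B} {g : B →ₗ[ℂ] C}
    (hf : Function.Injective f) (hg : Function.Surjective g) (hgf : ∀ a, g (f a) = 0) :
    ∃ (n : ℕ) (η : (Fin n → ℂ) →ₗ[ℂ] B) (h : C →ₗ[ℂ] B), g ∘ₗ h = LinearMap.id ∧
      Function.Bijective (f.coprod (η.coprod h)) := by
  obtain ⟨h, hh⟩ := g.exists_rightInverse_of_surjective (LinearMap.range_eq_top.2 hg)
  have hh' : ∀ x, g (h x) = x := fun x => LinearMap.congr_fun hh x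
  let R := (LinearMap.range f).submoduleOf (LinearMap.ker g)
  -- `s` lifts cohomology classes to cycles; composed with a basis of the cohomology it gives `η`,
  -- so the middle term is boundaries, lifted classes and a complement `Im h` of the cycles.
  obtain ⟨s, hs⟩ := R.mkQ.exists_rightInverse_of_surjective (Submodule.range_mkQ R)
  have hs' : ∀ x, R.mkQ (s x) = x := fun x => LinearMap.congr_fun hs x
  let e := (Module.finBasis ℂ (LinearMap.ker g ⧸ R)).equivFun.symm
  refine ⟨_, (LinearMap.ker g).subtype ∘ₗ s ∘ₗ e.toLinearMap, h, hh, ?_, ?_⟩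
  · rw [← LinearMap.ker_eq_bot, LinearMap.ker_eq_bot']
    rintro ⟨a, c, x⟩ h0
    simp only [LinearMap.coprod_apply, LinearMap.comp_apply, LinearEquiv.coe_coe,
      Submodule.subtype_apply] at h0
    have hx : x = 0 := by
      have := congrArg g h0
      rwa [map_add, map_add, hgf, hh', LinearMap.mem_ker.1 (s (e c)).2, zero_add, zero_add,
        map_zero] at this
    subst hx
    rw [map_zero, add_zero] at h0
    have hc : c = 0 := by
      have hm : s (e c) ∈ R := by
        change ((s (e c) : LinearMap.ker g) : B) ∈ LinearMap.range f
        rw [← neg_eq_of_add_eq_zero_right h0]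
        exact neg_mem ⟨a, rfl⟩
      have := hs' (e c)
      rw [Submodule.mkQ_apply, (Submodule.Quotient.mk_eq_zero R).2 hm] at this
      exact e.map_eq_zero_iff.1 this.symm
    subst hc
    rw [map_zero, map_zero, ZeroMemClass.coe_zero, add_zero] at h0
    rw [(map_eq_zero_iff f hf).1 h0]
    rfl
  · intro b
    -- Removing `h (g b)` leaves a cycle, and removing the lift of its class leaves a boundary.
    have hk : b - h (g b) ∈ LinearMap.ker g := by
      rw [LinearMap.mem_ker, map_sub, hh', sub_self]
    have hm : (⟨_, hk⟩ : LinearMap.ker g) - s (R.mkQ ⟨_, hk⟩) ∈ R := by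
      rw [← Submodule.Quotient.mk_eq_zero R, ← Submodule.mkQ_apply, map_sub, hs', sub_self]
    obtain ⟨a, ha⟩ := hm
    refine ⟨(a, e.symm (R.mkQ ⟨_, hk⟩), g b), ?_⟩
    simp only [LinearMap.coprod_apply, LinearMap.comp_apply, LinearEquiv.coe_coe,
      Submodule.subtype_apply, LinearEquiv.apply_symm_apply, ha]
    simp only [AddSubgroupClass.coe_sub]
    abel

variable {n : ℕ} {f : A →ₗ[ℂ] B} {g : B →ₗ[ℂ] C} {η : (Fin n → ℂ) →ₗ[ℂ] B} {h : C →ₗ[ℂ] B}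
  {Ψ : B →ₗ[ℂ] A × (Fin n → ℂ) × C} {R : C →ₗ[ℂ] C}

/-- The part `η` of a splitting, corrected to lie in the kernel of `g`. -/
def cycleMap (g : B →ₗ[ℂ] C) (η : (Fin n → ℂ) →ₗ[ℂ] B) (h : C →ₗ[ℂ] B) (R : C →ₗ[ℂ] C) :
    (Fin n → ℂ) →ₗ[ℂ] B := η - h ∘ₗ R ∘ₗ g ∘ₗ η

/-- When `f` and `g` vary with `η` and `h` fixed, `η` need not take values in cycles; since `R`
inverts `g h`, subtracting `h R g η` removes exactly the defect `g η`. -/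
theorem cycleMap_mem_ker (hR : (g ∘ₗ h) ∘ₗ R = LinearMap.id) (c : Fin n → ℂ) :
    g (cycleMap g η h R c) = 0 := by
  have := LinearMap.congr_fun hR (g (η c))
  simp only [LinearMap.comp_apply, LinearMap.id_apply] at this
  simp [cycleMap, this]

/-- The coordinates of a cycle modulo boundaries. -/
theorem sub_cycleMap_mem_range_iff (hgf : ∀ a, g (f a) = 0)
    (hR' : R ∘ₗ g ∘ₗ h = LinearMap.id)
    (hΨ : Ψ ∘ₗ f.coprod (η.coprod h) = LinearMap.id)
    (hΨ' : f.coprod (η.coprod h) ∘ₗ Ψ = LinearMap.id) {b : B} (hb : g b = 0) (c : Fin n → ℂ) :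
    b - cycleMap g η h R c ∈ LinearMap.range f ↔ (Ψ b).2.1 = c := by
  constructor
  · rintro ⟨a, ha⟩
    -- The correction term lies in `Im h`, so it leaves the middle coordinate `c` untouched.
    have h1 : b = f.coprod (η.coprod h) (a, c, -R (g (η c))) := by
      rw [eq_comm, sub_eq_iff_eq_add] at ha
      rw [ha]
      simp [cycleMap, sub_eq_add_neg]
    have h2 := LinearMap.congr_fun hΨ (a, c, -R (g (η c)))
    rw [LinearMap.comp_apply, ← h1] at h2
    rw [h2]
    rfl
  · rintro rfl
    have h1 := LinearMap.congr_fun hΨ' b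
    simp only [LinearMap.comp_apply, LinearMap.coprod_apply, LinearMap.id_apply] at h1
    -- Applying `R g` to the decomposition of the cycle `b` forces its last coordinate to be `-R (g
    -- (η c))`, which is the correction in `cycleMap`.
    have h2 := congrArg (fun x => R (g x)) h1
    have h3 := LinearMap.congr_fun hR' (Ψ b).2.2
    simp only [LinearMap.comp_apply, LinearMap.id_apply] at h3
    simp only [map_add, hgf, hb, map_zero, zero_add, h3] at h2
    refine ⟨(Ψ b).1, ?_⟩
    rw [eq_sub_iff_add_eq]
    refine Eq.trans ?_ h1
    simp only [cycleMap, LinearMap.sub_apply, LinearMap.comp_apply]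
    rw [eq_neg_of_add_eq_zero_left h2, map_neg, sub_neg_eq_add]

end Splitting

/-! ## The bundles of the complex and its middle cohomology -/

section Bundles

set_option linter.unusedSectionVars false

variable {I : Type*} [Quiver I] [Fintype I] [∀ i j : I, Fintype (i ⟶ j)]
variable {v w v' w' : I → ℕ}

/-- A family with local trivializations that detect regular sections is a vector bundle. -/
theorem isVectorBundle_of_trivialization {N : Type*} [AddCommGroup N] [Module ℂ N]
    [Module.Finite ℂ N] {E : Base v w v' w' → Type*} [∀ m, AddCommGroup (E m)]
    [∀ m, Module ℂ (E m)] {Reg : Set (Base v w v' w') → (∀ m, E m) → Prop}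
    (H : ∀ m₀, ∃ U : Set (Base v w v' w'), IsOpen[baseTopology] U ∧ m₀ ∈ U ∧
      ∃ Θ : ∀ m, N ≃ₗ[ℂ] E m, ∀ U' ⊆ U, ∀ σ : ∀ m, E m,
        Reg U' σ ↔ IsRegularMapOn coords (toBase ⁻¹' U') fun z =>
          (Θ (toBase z)).symm (σ (toBase z))) :
    IsVectorBundle E Reg (Module.finrank ℂ N) := by
  intro m₀
  obtain ⟨U, hU, hm₀, Θ, hΘ⟩ := H m₀
  let b := Module.finBasis ℂ N
  refine ⟨_, rfl, U, hU, hm₀, fun k m => Θ m (b k), ?_, ?_, ?_⟩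
  · intro k
    rw [hΘ U subset_rfl]
    exact (IsRegularMapOn.const (b k)).congr fun z _ => (Θ (toBase z)).symm_apply_apply _
  · intro m _
    exact ⟨(b.map (Θ m)).linearIndependent, (b.map (Θ m)).span_eq⟩
  · intro U' hU' _ c
    rw [hΘ U' hU']
    have h1 : ∀ z, (Θ (toBase z)).symm (∑ k, c k (toBase z) • Θ (toBase z) (b k)) =
        ∑ k, c k (toBase z) • b k := fun z => by simp
    simp only [h1]
    constructor
    · intro h k
      refine (h (b.coord k)).congr fun z _ => ?_
      rw [b.coord_apply, b.repr_sum_self]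
    · intro h
      exact IsRegularMapOn.sum _ fun k _ => IsRegularMapOn.smul (h k) (IsRegularMapOn.const (b k))

theorem isVectorBundle_outer : IsVectorBundle (v := v) (w := w) (v' := v') (w' := w') OuterFiber
    IsRegularOuter (Module.finrank ℂ (VertexHom (Std v') (Std v))) :=
  isVectorBundle_of_trivialization fun m₀ => by
    obtain ⟨L, hL⟩ := exists_localFrame m₀
    exact ⟨L.dom, L.isOpen_dom, hL, L.outer, fun U' hU' σ => L.isRegularOuter_iff hU'⟩

theorem isVectorBundle_middle : IsVectorBundle (v := v) (w := w) (v' := v') (w' := w') MiddleFiber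
    IsRegularMiddle (Module.finrank ℂ (FramedHom (Std v') (Std w') (Std v) (Std w))) :=
  isVectorBundle_of_trivialization fun m₀ => by
    obtain ⟨L, hL⟩ := exists_localFrame m₀
    exact ⟨L.dom, L.isOpen_dom, hL, L.middle, fun U' hU' σ => L.isRegularMiddle_iff hU'⟩

theorem IsRegularOuter.fiberF {U : Set (Base v w v' w')} {σ : ∀ m, OuterFiber m}
    (h : IsRegularOuter U σ) : IsRegularMiddle U fun m => fiberF m (σ m) :=
  (isRegular_fst.complexF isRegular_snd h).congr fun z _ =>
    (complexF_vertexMap (intertwines_tautEval z.1) (intertwines_tautEval z.2) _).symm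

theorem IsRegularMiddle.fiberG {U : Set (Base v w v' w')} {σ : ∀ m, MiddleFiber m}
    (h : IsRegularMiddle U σ) : IsRegularOuter U fun m => fiberG m (σ m) :=
  (isRegular_fst.complexG isRegular_snd h).congr fun z _ =>
    (complexG_framedMap (intertwines_tautEval z.1) (intertwines_tautEval z.2) _).symm

/-- Evaluation at a representative turns the fibre of the complex into the complex of two honest
stable representations with zero moment. The next two results use the same transport. -/
theorem fiberG_fiberF (m : Base v w v' w') (ψ : OuterFiber m) : fiberG m (fiberF m ψ) = 0 := by
  obtain ⟨z, rfl⟩ := toBase_surjective m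
  apply (vertexEquiv (tautEval z.1) (tautEval z.2)).injective
  refine Eq.trans ?_ (map_zero (vertexEquiv (tautEval z.1) (tautEval z.2))).symm
  have h1 := complexG_framedMap (intertwines_tautEval z.1) (intertwines_tautEval z.2)
    (fiberF (toBase z) ψ)
  have h2 := complexF_vertexMap (intertwines_tautEval z.1) (intertwines_tautEval z.2) ψ
  refine h1.symm.trans ((congrArg _ h2.symm).trans ?_)
  exact complexG_complexF z.1.moment_eq_zero z.2.moment_eq_zero _

theorem fiberF_injective (m : Base v w v' w') : Function.Injective (fiberF m) := by
  obtain ⟨z, rfl⟩ := toBase_surjective m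
  intro ψ χ h
  apply (vertexEquiv (tautEval z.1) (tautEval z.2)).injective
  apply complexF_injective (p := z.1.rep) z.2.stable
  have h1 := complexF_vertexMap (intertwines_tautEval z.1) (intertwines_tautEval z.2) ψ
  have h2 := complexF_vertexMap (intertwines_tautEval z.1) (intertwines_tautEval z.2) χ
  exact h1.trans ((congrArg _ h).trans h2.symm)

theorem fiberG_surjective (m : Base v w v' w') : Function.Surjective (fiberG m) := by
  obtain ⟨z, rfl⟩ := toBase_surjective m
  intro ψ
  obtain ⟨c, hc⟩ := complexG_surjective (p' := z.2.rep) z.1.stable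
    (vertexEquiv (tautEval z.1) (tautEval z.2) ψ)
  refine ⟨(framedEquiv (tautEval z.1) (tautEval z.2)).symm c, ?_⟩
  apply (vertexEquiv (tautEval z.1) (tautEval z.2)).injective
  rw [← hc]
  refine (complexG_framedMap (intertwines_tautEval z.1) (intertwines_tautEval z.2) _).symm.trans ?_
  exact congrArg _ ((framedEquiv (tautEval z.1) (tautEval z.2)).apply_symm_apply c)

/-! ### The complex in a local frame. -/

namespace LocalFrame

variable (L : LocalFrame v w v' w')

/-- The map `f` in a local frame. -/
def mapF (m : Base v w v' w') :
    VertexHom (Std v') (Std v) →ₗ[ℂ] FramedHom (Std v') (Std w') (Std v) (Std w) :=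
  complexF (L.repFst m) (L.repSnd m)

/-- The map `g` in a local frame. -/
def mapG (m : Base v w v' w') :
    FramedHom (Std v') (Std w') (Std v) (Std w) →ₗ[ℂ] VertexHom (Std v') (Std v) :=
  complexG (L.repFst m) (L.repSnd m)

theorem fiberF_outer (m : Base v w v' w') (ψ : VertexHom (Std v') (Std v)) :
    fiberF m (L.outer m ψ) = L.middle m (L.mapF m ψ) :=
  complexF_vertexMap (L.intertwines_fst m) (L.intertwines_snd m) ψ

theorem fiberG_middle (m : Base v w v' w')
    (c : FramedHom (Std v') (Std w') (Std v) (Std w)) :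
    fiberG m (L.middle m c) = L.outer m (L.mapG m c) :=
  complexG_framedMap (L.intertwines_fst m) (L.intertwines_snd m) c

theorem regular_mapF : IsRegularMapOn coords (toBase ⁻¹' L.dom) fun z => L.mapF (toBase z) :=
  IsRegularMapOn.of_apply fun ψ =>
    L.regular_repFst.complexF L.regular_repSnd (IsRegularMapOn.const ψ)

theorem regular_mapG : IsRegularMapOn coords (toBase ⁻¹' L.dom) fun z => L.mapG (toBase z) :=
  IsRegularMapOn.of_apply fun c =>
    L.regular_repFst.complexG L.regular_repSnd (IsRegularMapOn.const c)

theorem mapG_mapF (m : Base v w v' w') (ψ : VertexHom (Std v') (Std v)) :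
    L.mapG m (L.mapF m ψ) = 0 := by
  apply (L.outer m).injective
  rw [← fiberG_middle, ← fiberF_outer, fiberG_fiberF, map_zero]

theorem mapF_injective (m : Base v w v' w') : Function.Injective (L.mapF m) := by
  intro ψ χ h
  apply (L.outer m).injective
  apply fiberF_injective
  rw [fiberF_outer, fiberF_outer, h]

theorem mapG_surjective (m : Base v w v' w') : Function.Surjective (L.mapG m) := by
  intro ψ
  obtain ⟨c, hc⟩ := fiberG_surjective m (L.outer m ψ)
  refine ⟨(L.middle m).symm c, (L.outer m).injective ?_⟩
  rw [← fiberG_middle, LinearEquiv.apply_symm_apply, hc]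

theorem middle_mem_range_iff (m : Base v w v' w')
    (c : FramedHom (Std v') (Std w') (Std v) (Std w)) :
    L.middle m c ∈ LinearMap.range (fiberF m) ↔ c ∈ LinearMap.range (L.mapF m) := by
  constructor
  · rintro ⟨ψ, h⟩
    refine ⟨(L.outer m).symm ψ, (L.middle m).injective ?_⟩
    rw [← fiberF_outer, LinearEquiv.apply_symm_apply, h]
  · rintro ⟨ψ, rfl⟩
    exact ⟨L.outer m ψ, L.fiberF_outer m ψ⟩

end LocalFrame

/-! ### Cohomology classes and their regular frames. -/

open Classical in
/-- The class in the middle cohomology of an element of `C_0` if it is a cycle, and zero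
otherwise. -/
def cohomologyClass (m : Base v w v' w') (c : MiddleFiber m) : CohomologyFiber m :=
  if h : c ∈ LinearMap.ker (complexG (tautRep m.1) (tautRep m.2)) then
    Submodule.Quotient.mk ⟨c, h⟩ else 0

theorem cohomologyClass_eq {m : Base v w v' w'} {c : MiddleFiber m} (h : fiberG m c = 0) :
    cohomologyClass m c = Submodule.Quotient.mk ⟨c, h⟩ := dif_pos h

theorem cohomologyClass_sum {m : Base v w v' w'} {κ : Type*} (s : Finset κ)
    {c : κ → MiddleFiber m} (h : ∀ k, fiberG m (c k) = 0) (t : κ → ℂ) :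
    ∑ k ∈ s, t k • cohomologyClass m (c k) = cohomologyClass m (∑ k ∈ s, t k • c k) := by
  rw [cohomologyClass_eq (c := ∑ k ∈ s, t k • c k) (by simp [map_sum, h])]
  simp only [fun k => cohomologyClass_eq (h k)]
  refine (map_sum (Submodule.mkQ _) (fun k => t k • (⟨c k, h k⟩ :
    LinearMap.ker (complexG (tautRep m.1) (tautRep m.2)))) s).symm.trans ?_
  refine congrArg (Submodule.Quotient.mk) (Subtype.ext ?_)
  simp

theorem cohomologyClass_eq_iff {m : Base v w v' w'} {c d : MiddleFiber m} (hc : fiberG m c = 0)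
    (hd : fiberG m d = 0) :
    cohomologyClass m c = cohomologyClass m d ↔ c - d ∈ LinearMap.range (fiberF m) := by
  rw [cohomologyClass_eq hc, cohomologyClass_eq hd, Submodule.Quotient.eq]
  rfl

theorem exists_cohomologyClass {m : Base v w v' w'} (q : CohomologyFiber m) :
    ∃ c, fiberG m c = 0 ∧ q = cohomologyClass m c := by
  obtain ⟨⟨c, hc⟩, rfl⟩ := Submodule.Quotient.mk_surjective _ q
  exact ⟨c, hc, (cohomologyClass_eq hc).symm⟩

theorem isRegularCohomology_iff {U : Set (Base v w v' w')} {σ : ∀ m, CohomologyFiber m} :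
    IsRegularCohomology U σ ↔ ∀ m₀ ∈ U, ∃ U' ⊆ U, IsOpen[baseTopology] U' ∧ m₀ ∈ U' ∧
      ∃ c : ∀ m : Base v w v' w', MiddleFiber m, IsRegularMiddle U' c ∧
        ∀ m ∈ U', fiberG m (c m) = 0 ∧ σ m = cohomologyClass m (c m) := by
  have h : ∀ m (c : MiddleFiber m), (fiberG m c = 0 ∧ σ m = cohomologyClass m c) ↔
      ∃ h : c ∈ LinearMap.ker (complexG (tautRep m.1) (tautRep m.2)),
        σ m = Submodule.Quotient.mk ⟨c, h⟩ := by
    intro m c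
    constructor
    · rintro ⟨h1, h2⟩
      exact ⟨h1, h2.trans (cohomologyClass_eq h1)⟩
    · rintro ⟨h1, h2⟩
      exact ⟨h1, h2.trans (cohomologyClass_eq h1).symm⟩
  simp only [h]
  rfl

/-- Over a smaller open set, a splitting of the complex at one point is a splitting at all
points. -/
theorem exists_cohomology_frame (m₀ : Base v w v' w') :
    ∃ (L : LocalFrame v w v' w') (n : ℕ) (U : Set (Base v w v' w')),
      n + 2 * Module.finrank ℂ (VertexHom (Std v') (Std v)) =
        Module.finrank ℂ (FramedHom (Std v') (Std w') (Std v) (Std w)) ∧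
      IsOpen[baseTopology] U ∧ m₀ ∈ U ∧ U ⊆ L.dom ∧
      ∃ (ξ : Base v w v' w' → (Fin n → ℂ) →ₗ[ℂ] FramedHom (Std v') (Std w') (Std v) (Std w))
        (κ : Base v w v' w' → FramedHom (Std v') (Std w') (Std v) (Std w) →ₗ[ℂ] (Fin n → ℂ)),
        IsRegularMapOn coords (toBase ⁻¹' U) (fun z => ξ (toBase z)) ∧
        IsRegularMapOn coords (toBase ⁻¹' U) (fun z => κ (toBase z)) ∧
        ∀ m ∈ U, (∀ t, L.mapG m (ξ m t) = 0) ∧ ∀ c, L.mapG m c = 0 → ∀ t,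
          (c - ξ m t ∈ LinearMap.range (L.mapF m) ↔ κ m c = t) := by
  classical
  obtain ⟨L, hL⟩ := exists_localFrame m₀
  obtain ⟨n, η, h, hgh, hbij⟩ := exists_splitting (L.mapF_injective m₀) (L.mapG_surjective m₀)
    (L.mapG_mapF m₀)
  let Φ := fun m => (L.mapF m).coprod (η.coprod h)
  have hΦ : IsRegularMapOn coords (toBase ⁻¹' L.dom) fun z => Φ (toBase z) := by
    refine IsRegularMapOn.of_apply fun x => ?_
    exact (L.regular_mapF.apply (IsRegularMapOn.const x.1)).add
      (IsRegularMapOn.const (η.coprod h x.2))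
  have hG : IsRegularMapOn coords (toBase ⁻¹' L.dom) fun z => L.mapG (toBase z) ∘ₗ h :=
    L.regular_mapG.comp (IsRegularMapOn.const h)
  -- Two open conditions that hold at `m₀`: `η` and `h` still complete `Im f` to a splitting, and `g
  -- h` is still invertible, though no longer the identity.
  let U : Set (Base v w v' w') := {m | m ∈ L.dom ∧ Function.Bijective (Φ m) ∧
    Function.Bijective (L.mapG m ∘ₗ h)}
  have hU : IsOpen[baseTopology] U := by
    let := zariskiTopology (coords (v := v) (w := w) (v' := v') (w' := w'))
    have h1 := (hΦ.isOpen_bijective L.isOpen_dom).inter (hG.isOpen_bijective L.isOpen_dom)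
    rw [isOpen_base_iff]
    convert h1 using 1
    ext z
    simp only [U, Set.mem_preimage, Set.mem_ofPred_eq, Set.mem_inter_iff]
    tauto
  have hUL : U ⊆ L.dom := fun m hm => hm.1
  have hUL' : toBase ⁻¹' U ⊆ toBase ⁻¹' L.dom := Set.preimage_mono hUL
  -- `Ψ` and `R` are the inverses of `Φ` and `g h`; the value zero only occurs outside `U`.
  let Ψ := fun m => if hm : Function.Bijective (Φ m) then
    (LinearEquiv.ofBijective (Φ m) hm).symm.toLinearMap else 0
  let R := fun m => if hm : Function.Bijective (L.mapG m ∘ₗ h) then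
    (LinearEquiv.ofBijective (L.mapG m ∘ₗ h) hm).symm.toLinearMap else 0
  have hΨ : ∀ m ∈ U, Ψ m ∘ₗ Φ m = LinearMap.id := fun m hm => by
    simp only [Ψ, dif_pos hm.2.1]
    exact LinearMap.ext fun x => (LinearEquiv.ofBijective (Φ m) hm.2.1).symm_apply_apply x
  have hΨ' : ∀ m ∈ U, Φ m ∘ₗ Ψ m = LinearMap.id := fun m hm => by
    simp only [Ψ, dif_pos hm.2.1]
    exact LinearMap.ext fun x => (LinearEquiv.ofBijective (Φ m) hm.2.1).apply_symm_apply x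
  have hR : ∀ m ∈ U, R m ∘ₗ L.mapG m ∘ₗ h = LinearMap.id := fun m hm => by
    simp only [R, dif_pos hm.2.2]
    exact LinearMap.ext fun x =>
      (LinearEquiv.ofBijective (L.mapG m ∘ₗ h) hm.2.2).symm_apply_apply x
  have hR' : ∀ m ∈ U, (L.mapG m ∘ₗ h) ∘ₗ R m = LinearMap.id := fun m hm => by
    simp only [R, dif_pos hm.2.2]
    exact LinearMap.ext fun x =>
      (LinearEquiv.ofBijective (L.mapG m ∘ₗ h) hm.2.2).apply_symm_apply x
  have hΨr : IsRegularMapOn coords (toBase ⁻¹' U) fun z => Ψ (toBase z) :=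
    (hΦ.mono hUL').inverse (fun z hz => hΨ _ hz) (fun z hz => hΨ' _ hz)
  have hRr : IsRegularMapOn coords (toBase ⁻¹' U) fun z => R (toBase z) :=
    (hG.mono hUL').inverse (fun z hz => hR _ hz) (fun z hz => hR' _ hz)
  refine ⟨L, n, U, ?_, hU, ⟨hL, hbij, ?_⟩, hUL, fun m => cycleMap (L.mapG m) η h (R m),
    fun m => LinearMap.fst ℂ _ _ ∘ₗ LinearMap.snd ℂ _ _ ∘ₗ Ψ m, ?_, ?_, fun m hm => ⟨?_, ?_⟩⟩
  -- The splitting at `m₀` counts dimensions: both outer terms have the same dimension, whence the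
  -- factor 2.
  · rw [← (LinearEquiv.ofBijective _ hbij).finrank_eq, Module.finrank_prod, Module.finrank_prod,
      Module.finrank_fin_fun]
    ring
  · rw [hgh]
    exact Function.bijective_id
  · exact (IsRegularMapOn.const η).sub ((IsRegularMapOn.const h).comp
      (hRr.comp ((L.regular_mapG.mono hUL').comp (IsRegularMapOn.const η))))
  · exact (IsRegularMapOn.const _).comp ((IsRegularMapOn.const _).comp hΨr)
  · exact fun t => cycleMap_mem_ker (hR' m hm) t
  · exact fun c hc t => sub_cycleMap_mem_range_iff (L.mapG_mapF m) (hR m hm)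
      (hΨ m hm) (hΨ' m hm) hc t

/-- The frame consists of the classes of the cycles `ξ e_k`, and the coefficients of the class of a
cycle `c` are `κ c`. Regularity of `ξ` turns regular coefficients into regular sections, and
regularity of `κ` gives the converse. -/
theorem isVectorBundle_cohomology {r : ℤ}
    (hr : (Module.finrank ℂ (FramedHom (Std v') (Std w') (Std v) (Std w)) : ℤ)
      - 2 * Module.finrank ℂ (VertexHom (Std v') (Std v)) = r) :
    IsVectorBundle (v := v) (w := w) (v' := v') (w' := w') CohomologyFiber
      IsRegularCohomology r := by
  intro m₀
  obtain ⟨L, n, U, hn, hU, hm₀, hUL, ξ, κ, hξ, hκ, hξκ⟩ := exists_cohomology_frame m₀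
  have hb : ∀ (t : Fin n → ℂ) m, ∑ k, t k • L.middle m (ξ m (Pi.single k 1)) =
      L.middle m (ξ m t) := fun t m => by
    simp only [← map_smul, ← map_sum]
    congr 2
    conv_rhs => rw [← Finset.univ_sum_single t]
    exact Finset.sum_congr rfl fun k _ => by rw [← Pi.single_smul, smul_eq_mul, mul_one]
  have hcyc : ∀ m ∈ U, ∀ t, fiberG m (L.middle m (ξ m t)) = 0 := fun m hm t => by
    rw [L.fiberG_middle, (hξκ m hm).1, map_zero]
  have hsum : ∀ m ∈ U, ∀ t : Fin n → ℂ,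
      ∑ k, t k • cohomologyClass m (L.middle m (ξ m (Pi.single k 1))) =
        cohomologyClass m (L.middle m (ξ m t)) := fun m hm t => by
    rw [cohomologyClass_sum _ fun k => hcyc m hm _, hb]
  have hcoef : ∀ m ∈ U, ∀ c : MiddleFiber m, fiberG m c = 0 → ∀ t : Fin n → ℂ,
      cohomologyClass m c =
        ∑ k, t k • cohomologyClass m (L.middle m (ξ m (Pi.single k 1))) ↔
      κ m ((L.middle m).symm c) = t := fun m hm c hc t => by
    have hc' : L.mapG m ((L.middle m).symm c) = 0 := by
      apply (L.outer m).injective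
      rw [← L.fiberG_middle, LinearEquiv.apply_symm_apply, hc, map_zero]
    rw [hsum m hm, cohomologyClass_eq_iff hc (hcyc m hm t), ← (hξκ m hm).2 _ hc' t,
      ← L.middle_mem_range_iff, map_sub, LinearEquiv.apply_symm_apply]
  refine ⟨n, by rw [← hr, ← hn]; push_cast; ring, U, hU, hm₀,
    fun k m => cohomologyClass m (L.middle m (ξ m (Pi.single k 1))), ?_, ?_, ?_⟩
  · intro k
    rw [isRegularCohomology_iff]
    refine fun m hm => ⟨U, subset_rfl, hU, hm, fun m => L.middle m (ξ m (Pi.single k 1)), ?_,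
      fun m hm => ⟨hcyc m hm _, rfl⟩⟩
    rw [L.isRegularMiddle_iff hUL]
    exact (hξ.apply (IsRegularMapOn.const _)).congr fun z _ =>
      (L.middle (toBase z)).symm_apply_apply _
  · intro m hm
    constructor
    · rw [Fintype.linearIndependent_iff]
      intro t ht k
      have h0 : cohomologyClass m 0 = 0 := by
        rw [cohomologyClass_eq (map_zero (fiberG m))]
        exact Submodule.Quotient.mk_zero _
      -- A vanishing combination represents the class of the zero cycle, so its coefficients are `κ
      -- 0 = 0`.
      have h1 := (hcoef m hm 0 (map_zero _) t).1 (h0.trans ht.symm)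
      rw [← h1, map_zero, map_zero]
      rfl
    · rw [eq_top_iff]
      rintro q -
      obtain ⟨c, hc, rfl⟩ := exists_cohomologyClass q
      rw [(hcoef m hm c hc _).2 rfl]
      exact Submodule.sum_mem _ fun k _ => Submodule.smul_mem _ _ (Submodule.subset_span ⟨k, rfl⟩)
  · intro U' hU' hU'o c
    constructor
    · intro h
      rw [isRegularCohomology_iff] at h
      intro k
      -- A regular section of the cohomology has regular lifts to `C_0` only locally, so the
      -- coefficients are computed as `κ` of a local lift.
      refine IsRegularFunctionOn.of_local fun z hz => ?_
      obtain ⟨U'', hU'', hU''o, hzU'', d, hd, hdc⟩ := h (toBase z) hz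
      have hsub := hU''.trans hU'
      refine ⟨toBase ⁻¹' U'', hU''o, hzU'', ?_⟩
      rw [L.isRegularMiddle_iff (hsub.trans hUL)] at hd
      refine IsRegularFunctionOn.congr
        (((hκ.mono (Set.preimage_mono hsub)).apply hd).component k (LinearMap.id)) fun y hy => ?_
      obtain ⟨h1, h2⟩ := hdc _ hy
      have h3 := (hcoef _ (hsub hy) _ h1 fun k => c k (toBase y)).1 h2.symm
      exact (congrFun h3 k).symm
    · intro h
      rw [isRegularCohomology_iff]
      refine fun m hm => ⟨U', subset_rfl, hU'o, hm, fun m => L.middle m (ξ m fun k => c k m), ?_,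
        fun m hm => ⟨hcyc m (hU' hm) _, hsum m (hU' hm) _⟩⟩
      rw [L.isRegularMiddle_iff (hU'.trans hUL)]
      exact ((hξ.mono (Set.preimage_mono hU')).apply (IsRegularMapOn.of_components
        fun k => IsRegularMapOn.of_function (h k))).congr fun z _ =>
          (L.middle (toBase z)).symm_apply_apply _

theorem isRegularCohomology_lociSection (π : ∀ i, Std w' i →ₗ[ℂ] Std w i) :
    IsRegularCohomology (v := v) (w := w) (v' := v') (w' := w') Set.univ (lociSection π) := by
  refine fun m _ => ⟨Set.univ, subset_rfl, @isOpen_univ _ baseTopology, trivial,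
    fun m => sectionVector π (tautRep m.1) (tautRep m.2), ?_,
    fun m _ => ⟨sectionVector_mem_ker π _ _, rfl⟩⟩
  exact (isRegular_fst.sectionVector π isRegular_snd).congr fun z _ =>
    (sectionVector_framedMap (intertwines_tautEval z.1) (intertwines_tautEval z.2) π).symm

/-- Vanishing means that `s = f ψ` on the tautological fibres; evaluation at the given
representatives carries such `ψ` to horizontal maps between them, and back. -/
theorem lociSection_toBase_eq_zero_iff (π : ∀ i, Std w' i →ₗ[ℂ] Std w i)
    (p : StableRep v w) (p' : StableRep v' w') :
    lociSection π (toBase (p, p')) = 0 ↔ ∃ ψ, IsFramedMorphism π p'.rep p.rep ψ := by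
  refine sectionClass_eq_zero_iff.trans ?_
  have hF := complexF_vertexMap (intertwines_tautEval p) (intertwines_tautEval p')
  have hs := sectionVector_framedMap (intertwines_tautEval p) (intertwines_tautEval p') π
  simp only [← complexF_eq_sectionVector_iff]
  constructor
  · rintro ⟨ψ, h⟩
    exact ⟨_, (hF ψ).trans ((congrArg _ h).trans hs.symm)⟩
  · rintro ⟨ψ, h⟩
    refine ⟨(vertexEquiv (tautEval p) (tautEval p')).symm ψ,
      (framedEquiv (tautEval p) (tautEval p')).injective ?_⟩
    refine (hF _).symm.trans (Eq.trans ?_ (h.trans hs))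
    exact congrArg _ ((vertexEquiv (tautEval p) (tautEval p')).apply_symm_apply ψ)

/-! ### Torus equivariance -/

/-- A translated vector takes at `p` the value of the original one at `τ⁻¹ • p`, so the scaling by
`τ` cancels against the one by `τ⁻¹`. With naturality this reduces equivariance to the scaling
identities. -/
theorem intertwines_tautTranslate (τ : Torus I) (m : NakajimaVariety v w) :
    Intertwines (torusScale τ (tautRep m)) (tautRep (torusAct τ m)) (tautTranslate τ m) := by
  refine ⟨fun i j e => ?_, fun i j e => ?_, fun i => ?_, fun i => ?_⟩
  · refine LinearMap.ext fun s => Taut.ext (funext fun p => ?_)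
    change p.1.rep.x e (s.val ⟨τ⁻¹ • p.1, torus_inv_mem τ p⟩) =
      (τ.2 i j e : ℂ)⁻¹ • (((τ⁻¹).2 i j e : ℂˣ) : ℂ)⁻¹ • p.1.rep.x e _
    rw [smul_smul, Prod.snd_inv, Pi.inv_apply, Pi.inv_apply, Pi.inv_apply,
      Units.val_inv_eq_inv_val, inv_inv, inv_mul_cancel₀ (Units.ne_zero _), one_smul]
  · refine LinearMap.ext fun s => Taut.ext (funext fun p => ?_)
    change p.1.rep.y e (s.val ⟨τ⁻¹ • p.1, torus_inv_mem τ p⟩) =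
      ((τ.2 i j e : ℂ) / (τ.1 : ℂ)) •
        ((((τ⁻¹).2 i j e : ℂˣ) : ℂ) / (((τ⁻¹).1 : ℂˣ) : ℂ)) • p.1.rep.y e _
    rw [smul_smul, Prod.snd_inv, Prod.fst_inv, Pi.inv_apply, Pi.inv_apply, Pi.inv_apply,
      Units.val_inv_eq_inv_val, Units.val_inv_eq_inv_val, div_mul_div_comm,
      mul_inv_cancel₀ (Units.ne_zero _), mul_inv_cancel₀ (Units.ne_zero _), div_one, one_smul]
  · exact LinearMap.ext fun u => Taut.ext rfl
  · refine LinearMap.ext fun s => ?_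
    -- The chosen representatives of the two orbits are unrelated, so the second `B` is recomputed
    -- at `τ⁻¹ • p`.
    let p : OrbitFiber (torusAct τ m) := ⟨(torusAct τ m).out, Quotient.out_eq _⟩
    change (tautRep (torusAct τ m)).b i (tautTranslate τ m i s) =
      (τ.1 : ℂ)⁻¹ • (tautRep m).b i s
    rw [tautRep_b_apply _ i s ⟨τ⁻¹ • p.1, torus_inv_mem τ p⟩, tautRep_b_apply _ i _ p]
    change p.1.rep.b i (s.val ⟨τ⁻¹ • p.1, torus_inv_mem τ p⟩) =
      (τ.1 : ℂ)⁻¹ • (((τ⁻¹).1 : ℂˣ) : ℂ)⁻¹ • p.1.rep.b i _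
    rw [smul_smul, Prod.fst_inv, Units.val_inv_eq_inv_val, inv_inv,
      inv_mul_cancel₀ (Units.ne_zero _), one_smul]

theorem translateMiddle_eq (τ : Torus I) (m : Base v w v' w') (c : MiddleFiber m) :
    translateMiddle τ m c = framedMap (fun i => (tautTranslate τ m.1 i).toLinearMap)
      (fun i => (tautTranslate τ m.2 i).symm.toLinearMap) (torusScale τ c) :=
  torusScale_framedMap τ _ _ c

theorem fiberF_translate (τ : Torus I) (m : Base v w v' w') :
    fiberF (torusActBase τ m) ∘ₗ translateNeg τ m = translateMiddle τ m ∘ₗ fiberF m := by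
  refine LinearMap.ext fun ψ => ?_
  refine (complexF_vertexMap (intertwines_tautTranslate τ m.1)
    (intertwines_tautTranslate τ m.2) ψ).trans ?_
  rw [complexF_torusScale]
  exact (translateMiddle_eq τ m _).symm

theorem fiberG_translate (τ : Torus I) (m : Base v w v' w') :
    fiberG (torusActBase τ m) ∘ₗ translateMiddle τ m = translatePos τ m ∘ₗ fiberG m := by
  refine LinearMap.ext fun c => ?_
  refine (congrArg (fiberG (torusActBase τ m)) (translateMiddle_eq τ m c)).trans ?_
  refine (complexG_framedMap (intertwines_tautTranslate τ m.1)
    (intertwines_tautTranslate τ m.2) _).trans ?_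
  rw [complexG_torusScale, map_smul]
  rfl

theorem translateMiddle_sectionVector (π : ∀ i, Std w' i →ₗ[ℂ] Std w i) (τ : Torus I)
    (m : Base v w v' w') :
    translateMiddle τ m (sectionVector π (tautRep m.1) (tautRep m.2)) =
      sectionVector π (tautRep (torusActBase τ m).1) (tautRep (torusActBase τ m).2) := by
  rw [translateMiddle_eq, ← sectionVector_torusScale]
  exact (sectionVector_framedMap (intertwines_tautTranslate τ m.1)
    (intertwines_tautTranslate τ m.2) π).symm

end Bundles

end

end NakajimaQuiver

/-! ### The theorem. -/

open NakajimaQuiver in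
theorem proposition2p8 {I : Type*} [Quiver I] [Fintype I] [∀ i j : I, Fintype (i ⟶ j)]
    (v v' w w' : I → ℕ) (π : ∀ i, Std w' i →ₗ[ℂ] Std w i) :
    -- `C_{-1} → C_0 → C_1` is a complex of torus-equivariant vector bundles on the product
    ((∃ r, IsVectorBundle (v := v) (w := w) (v' := v') (w' := w') OuterFiber IsRegularOuter r) ∧
      (∃ r, IsVectorBundle (v := v) (w := w) (v' := v') (w' := w') MiddleFiber IsRegularMiddle r) ∧
      (∀ (U : Set (Base v w v' w')) (σ : ∀ m, OuterFiber m), IsOpen[baseTopology] U →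
        IsRegularOuter U σ → IsRegularMiddle U fun m => fiberF m (σ m)) ∧
      (∀ (U : Set (Base v w v' w')) (σ : ∀ m, MiddleFiber m), IsOpen[baseTopology] U →
        IsRegularMiddle U σ → IsRegularOuter U fun m => fiberG m (σ m)) ∧
      (∀ m : Base v w v' w', fiberG m ∘ₗ fiberF m = 0) ∧
      (∀ (τ : Torus I) (m : Base v w v' w'),
        fiberF (torusActBase τ m) ∘ₗ translateNeg τ m = translateMiddle τ m ∘ₗ fiberF m ∧
        fiberG (torusActBase τ m) ∘ₗ translateMiddle τ m = translatePos τ m ∘ₗ fiberG m)) ∧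
    -- `f` is fiberwise injective and `g` is fiberwise surjective
    (∀ m : Base v w v' w', Function.Injective (fiberF m)) ∧
    (∀ m : Base v w v' w', Function.Surjective (fiberG m)) ∧
    -- the middle cohomology is a vector bundle of the stated rank
    IsVectorBundle (v := v) (w := w) (v' := v') (w' := w') CohomologyFiber IsRegularCohomology
      (dot (fun i => (w i : ℤ)) (fun i => (v' i : ℤ)) + dot (fun i => (w' i : ℤ)) (fun i => (v i : ℤ))
        - symForm (fun i => (v i : ℤ)) (fun i => (v' i : ℤ))) ∧
    -- `s` is a regular, torus-invariant, global section of it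
    IsRegularCohomology (v := v) (w := w) (v' := v') (w' := w') Set.univ (lociSection π) ∧
    (∀ (τ : Torus I) (m : Base v w v' w'),
      translateMiddle τ m (sectionVector π (tautRep m.1) (tautRep m.2)) =
        sectionVector π (tautRep (torusActBase τ m).1) (tautRep (torusActBase τ m).2)) ∧
    -- its zero locus, and uniqueness and surjectivity of the horizontal maps
    (∀ (p : StableRep v w) (p' : StableRep v' w'),
      (lociSection π (toBase (p, p')) = 0 ↔ ∃ ψ, IsFramedMorphism π p'.rep p.rep ψ) ∧
      (∀ ψ χ, IsFramedMorphism π p'.rep p.rep ψ → IsFramedMorphism π p'.rep p.rep χ → ψ = χ) ∧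
      ((∀ i, Function.Surjective (π i)) →
        ∀ ψ, IsFramedMorphism π p'.rep p.rep ψ → ∀ i, Function.Surjective (ψ i))) := by
  refine ⟨⟨⟨_, isVectorBundle_outer⟩, ⟨_, isVectorBundle_middle⟩, fun _ _ _ h => h.fiberF,
      fun _ _ _ h => h.fiberG, fun m => LinearMap.ext fun ψ => fiberG_fiberF m ψ,
      fun τ m => ⟨fiberF_translate τ m, fiberG_translate τ m⟩⟩,
    fiberF_injective, fiberG_surjective,
    isVectorBundle_cohomology (finrank_complex v v' w w'),
    isRegularCohomology_lociSection π, translateMiddle_sectionVector π,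
    fun p p' => ⟨lociSection_toBase_eq_zero_iff π p p', fun _ _ h h' => h.ext p'.stable h',
      fun hπ _ h => h.surjective p.stable hπ⟩⟩
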